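/- **Setting.** Let $n\ge 1$, $G=\mathrm{GL}(n,\mathbb C)$ as a real Lie group, $\mathcal G=\mathfrak{gl}(n,\mathbb C)$ with $\langle X,Y\rangle=\operatorname{Re}\operatorname{tr}(XY)$. For $X\in\mathcal G$ let $X^+=\frac12(X-X^*)$, $X^-=\frac12(X+X^*)$, let $X_0$ be the diagonal part, $r(X)=\frac12(X_>-X_<)$ (half the strictly upper minus half the strictly lower triangular part) and $r_\pm=r\pm\frac12\mathrm{id}$. On $\mathfrak M=G\times\mathcal G=\{(g,J)\}$ put, for $F\in C^\infty(\mathfrak M,\mathbb R)$ and all $X\in\mathcal G$, $$\langle\nabla_1F,X\rangle=\tfrac{d}{dt}\big|_0F(e^{tX}g,J),\quad \langle\nabla_1'F,X\rangle=\tfrac{d}{dt}\big|_0F(ge^{tX},J),\quad \langle d_2F,X\rangle=\tfrac{d}{dt}\big|_0F(g,J+tX),$$ $\nabla_2F=J\,d_2F$, $\nabla_2'F=(d_2F)J$, and $$\{F,H\}_1=\langle\nabla_1F,d_2H\rangle-\langle\nabla_1H,d_2F\rangle+\langle J,[d_2F,d_2H]\rangle,$$ $$\{F,H\}_2=\langle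 r\nabla_1F,\nabla_1H\rangle-\langle r\nabla_1'F,\nabla_1'H\rangle+\langle\nabla_2F-\nabla_2'F,\,r_+\nabla_2'H-r_-\nabla_2H\rangle+\langle\nabla_1F,\,r_+\nabla_2'H-r_-\nabla_2H\rangle-\langle\nabla_1H,\,r_+\nabla_2'F-r_-\nabla_2F\rangle.$$ Let $C^\infty(\mathfrak M)^{U(n)\times U(n)}$ be the real smooth functions invariant under $(g,J)\mapsto(g\eta^{-1},J)$ and $(g,J)\mapsto(\eta g,\eta J\eta^{-1})$ for all $\eta\in U(n)$. Let $\mathfrak M_0^{\rm reg}=\{(e^q,J): q=\operatorname{diag}(q_1,\dots,q_n)\in\mathbb R^{n},\ q_1>\dots>q_n,\ J\in\mathcal G\}$ with inclusion $\iota:\mathfrak M_0^{\rm reg}\to\mathfrak M$; let $C^\infty(\mathfrak M_0^{\rm reg})^{\mathbb T^n}$ be its real smooth functions invariant under $(e^q,J)\mapsto(e^q,\tau J\tau^{-1})$ for all diagonal unitary $\tau$, and let the reduced function ring be $$C^\infty(\mathfrak M)_{\rm red}=\{f\in C^\infty(\mathfrak M_0^{\rm reg})^{\mathbb T^n}: f=F\circ\iota\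 \text{for some}\ F\in C^\infty(\mathfrak M)^{U(n)\times U(n)}\}.$$ For functions $f$ on $\mathfrak M_0^{\rm reg}$, $d_2f$, $\nabla_2f=J\,d_2f$, $\nabla_2'f=(d_2f)J$ are defined as above, $\nabla_1f=\operatorname{diag}(\partial f/\partial q_1,\dots,\partial f/\partial q_n)$, and $R(q)X$ has entries $(R(q)X)_{ii}=0$, $(R(q)X)_{ij}=X_{ij}\coth(q_i-q_j)$ for $i\ne j$. Consider the formulas, at $(e^q,J)$, $$\begin{aligned}\{f,h\}^{\rm red}_1&=\langle\nabla_1f,(d_2h)^-_0\rangle-\langle\nabla_1h,(d_2f)^-_0\rangle+\langle R(q)[d_2f,J]^+,(d_2h)^-\rangle-\langle R(q)[d_2h,J]^+,(d_2f)^-\rangle\\&\quad+\langle J^+,[(d_2f)^-,(d_2h)^-]-[(d_2f)^+,(d_2h)^+]\rangle,\end{aligned}\tag{redPB1}$$ $$\begin{aligned}2\{f,h\}^{\rm red}_2&=\langle\nabla_1f,(\nabla_2h+\nabla_2'h)^-_0\rangle-\langle\nabla_1h,(\nabla_2f+\nabla_2'f)^-_0\rangle\\&\quad+\langle R(q)[d_2f,J]^+,(\nabla_2h+\nabla_2'h)^-\rangle-\langle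 R(q)[d_2h,J]^+,(\nabla_2f+\nabla_2'f)^-\rangle\\&\quad+\langle(\nabla_2f)^-,(\nabla_2'h)^-\rangle+\langle(\nabla_2'f)^+,(\nabla_2h)^+\rangle-\langle(\nabla_2'f)^-,(\nabla_2h)^-\rangle-\langle(\nabla_2f)^+,(\nabla_2'h)^+\rangle.\end{aligned}\tag{redPB2}$$ **Proposition 3.6.** (redPB1) and (redPB2) are the reduced brackets, that is, $\{F\circ\iota,H\circ\iota\}^{\rm red}_i=\{F,H\}_i\circ\iota$ for all $F,H\in C^\infty(\mathfrak M)^{U(n)\times U(n)}$ and $i=1,2$. They are two Poisson brackets on $C^\infty(\mathfrak M)_{\rm red}$ (each maps this ring to itself, is bilinear, antisymmetric, a derivation in each argument, and satisfies the Jacobi identity); they are linearly independent, and they are compatible: every real linear combination of them is again a Poisson bracket on $C^\infty(\mathfrak M)_{\rm red}$. For every integer $k\ge1$ the functions $h_k=\frac1k\operatorname{Re}\operatorname{tr}(J^k)$ and $\tilde h_k=\frac1k\operatorname{Im}\operatorname{tr}(J^k)$ belong to $C^\infty(\mathfrak M)_{\rm red}$; all of them commute with each other with respect to both brackets; and they generate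 a bi-Hamiltonian hierarchy: for all $f\in C^\infty(\mathfrak M)_{\rm red}$ and $k\ge1$, $$\{f,h_k\}^{\rm red}_2=\{f,h_{k+1}\}^{\rm red}_1,\qquad \{f,\tilde h_k\}^{\rm red}_2=\{f,\tilde h_{k+1}\}^{\rm red}_1 .$$ -/

import Mathlib

open scoped ContDiff
open scoped Matrix.Norms.Operator

noncomputable section

namespace SpinSutherland

/-! ### Poisson brackets on algebras of functions -/

/-- `B` is a Poisson bracket on the algebra `A` of real functions on `X`: it maps `A × A` into `A`,
and on `A` it is bilinear, antisymmetric, a derivation in each argument, and satisfies the Jacobi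
identity (linearity and the derivation property in the second argument follow by antisymmetry). -/
structure IsPoissonBracketOn {X : Type*} (A : Subalgebra ℝ (X → ℝ))
    (B : (X → ℝ) → (X → ℝ) → (X → ℝ)) : Prop where
  closed : ∀ f ∈ A, ∀ h ∈ A, B f h ∈ A
  add_left : ∀ f ∈ A, ∀ g ∈ A, ∀ h ∈ A, B (f + g) h = B f h + B g h
  smul_left : ∀ c : ℝ, ∀ f ∈ A, ∀ h ∈ A, B (c • f) h = c • B f h
  antisymm : ∀ f ∈ A, ∀ h ∈ A, B f h = - B h f
  leibniz : ∀ f ∈ A, ∀ g ∈ A, ∀ h ∈ A, B (f * g) h = f * B g h + B f h * g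
  jacobi : ∀ f ∈ A, ∀ g ∈ A, ∀ h ∈ A, B f (B g h) + B g (B h f) + B h (B f g) = 0

/-- Two brackets are compatible on `A` if all their linear combinations are Poisson brackets. -/
def CompatibleOn {X : Type*} (A : Subalgebra ℝ (X → ℝ))
    (B₁ B₂ : (X → ℝ) → (X → ℝ) → (X → ℝ)) : Prop :=
  ∀ a b : ℝ, IsPoissonBracketOn A (fun f h => a • B₁ f h + b • B₂ f h)

/-- Two brackets are linearly independent on `A`. -/
def IndependentOn {X : Type*} (A : Subalgebra ℝ (X → ℝ))
    (B₁ B₂ : (X → ℝ) → (X → ℝ) → (X → ℝ)) : Prop :=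
  ∀ a b : ℝ, (∀ f ∈ A, ∀ h ∈ A, a • B₁ f h + b • B₂ f h = 0) → a = 0 ∧ b = 0

/-! ### Linear algebra on the real Lie algebra `gl(n,ℂ)` -/

/-- Complex `n × n` matrices. -/
abbrev Mat (n : ℕ) : Type := Matrix (Fin n) (Fin n) ℂ

/-- The group `GL(n,ℂ)`. -/
abbrev GLn (n : ℕ) : Type := Matrix.GeneralLinearGroup (Fin n) ℂ

/-- The real trace form `⟨X, Y⟩ = Re tr (X Y)`. -/
def pairing {n : ℕ} (X Y : Mat n) : ℝ := (X * Y).trace.re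

/-- The matrix `Y` with `⟨Y, X⟩ = ℓ X` for all `X`, for a real linear functional `ℓ`
(see `pairing_dualMatrix`). -/
def dualMatrix {n : ℕ} (ℓ : Mat n → ℝ) : Mat n :=
  Matrix.of fun i j =>
    (ℓ (Matrix.single j i 1) : ℂ) - Complex.I * (ℓ (Matrix.single j i Complex.I) : ℂ)

theorem pairing_dualMatrix {n : ℕ} (ℓ : Mat n →ₗ[ℝ] ℝ) (X : Mat n) :
    pairing (dualMatrix ℓ) X = ℓ X := by
  have h1 : ∀ (i j : Fin n) (z : ℂ), Matrix.single i j z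
      = z.re • (Matrix.single i j 1 : Mat n) + z.im • (Matrix.single i j Complex.I : Mat n) := by
    intro i j z
    rw [Matrix.smul_single, Matrix.smul_single, ← Matrix.single_add]
    congr 1
    apply Complex.ext <;> simp
  have h2 : ℓ X = ∑ i, ∑ j, ((X i j).re * ℓ (Matrix.single i j 1)
      + (X i j).im * ℓ (Matrix.single i j Complex.I)) := by
    conv_lhs => rw [Matrix.matrix_eq_sum_single X]
    rw [map_sum]
    refine Finset.sum_congr rfl fun i _ => ?_
    rw [map_sum]
    refine Finset.sum_congr rfl fun j _ => ?_
    rw [h1 i j (X i j), map_add, map_smul, map_smul, smul_eq_mul, smul_eq_mul]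
  rw [h2, Finset.sum_comm]
  simp only [pairing, dualMatrix, Matrix.trace, Matrix.diag, Matrix.mul_apply, Matrix.of_apply,
    Complex.re_sum]
  refine Finset.sum_congr rfl fun i _ => Finset.sum_congr rfl fun j _ => ?_
  simp
  ring

/-- The commutator `[X, Y]`. -/
def comm {n : ℕ} (X Y : Mat n) : Mat n := X * Y - Y * X

/-- The anti-Hermitian part `X⁺`. -/
def aherm {n : ℕ} (X : Mat n) : Mat n := (2⁻¹ : ℂ) • (X - X.conjTranspose)

/-- The Hermitian part `X⁻`. -/
def herm {n : ℕ} (X : Mat n) : Mat n := (2⁻¹ : ℂ) • (X + X.conjTranspose)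

/-- The diagonal part `X₀`. -/
def diagPart {n : ℕ} (X : Mat n) : Mat n := Matrix.diagonal fun i => X i i

/-- `r(X) = (X_> - X_<) / 2`, with the strictly upper and strictly lower triangular parts. -/
def rMat {n : ℕ} (X : Mat n) : Mat n :=
  Matrix.of fun i j => if i < j then X i j / 2 else if j < i then - X i j / 2 else 0

/-- `r₊ = r + id/2`. -/
def rPlus {n : ℕ} (X : Mat n) : Mat n := rMat X + (2⁻¹ : ℂ) • X

/-- `r₋ = r - id/2`. -/
def rMinus {n : ℕ} (X : Mat n) : Mat n := rMat X - (2⁻¹ : ℂ) • X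

/-- `(R(q) X)ᵢᵢ = 0` and `(R(q) X)ᵢⱼ = coth (qᵢ - qⱼ) Xᵢⱼ` for `i ≠ j`. -/
def dynR {n : ℕ} (q : Fin n → ℝ) (X : Mat n) : Mat n :=
  Matrix.of fun i j =>
    if i = j then 0 else X i j * ((Real.cosh (q i - q j) / Real.sinh (q i - q j) : ℝ) : ℂ)

/-! ### The master phase space `𝔐 = GL(n,ℂ) × gl(n,ℂ)` and its two brackets -/

/-- The phase space `𝔐 = GL(n,ℂ) × gl(n,ℂ)`. -/
abbrev Phase (n : ℕ) : Type := GLn n × Mat n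

/-- `F ∈ C^∞(𝔐, ℝ)`, where `𝔐` is an open subset of the real vector space
`gl(n,ℂ) × gl(n,ℂ)`. -/
def SmoothOnPhase {n : ℕ} (F : Phase n → ℝ) : Prop :=
  ∃ Φ : Mat n × Mat n → ℝ, ContDiffOn ℝ ∞ Φ {p | IsUnit p.1} ∧
    ∀ x : Phase n, F x = Φ (x.1, x.2)

/-- The exponential map `gl(n,ℂ) → GL(n,ℂ)`. -/
def expGL {n : ℕ} (X : Mat n) : GLn n := (Matrix.isUnit_exp X).unit

/-- `⟨∇₁F(g,J), X⟩ = d/dt F(e^{tX} g, J)` at `t = 0`. -/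
def nabla1 {n : ℕ} (F : Phase n → ℝ) (x : Phase n) : Mat n :=
  dualMatrix fun X => deriv (fun t : ℝ => F (expGL (t • X) * x.1, x.2)) 0

/-- `⟨∇₁'F(g,J), X⟩ = d/dt F(g e^{tX}, J)` at `t = 0`. -/
def nabla1' {n : ℕ} (F : Phase n → ℝ) (x : Phase n) : Mat n :=
  dualMatrix fun X => deriv (fun t : ℝ => F (x.1 * expGL (t • X), x.2)) 0

/-- `⟨d₂F(g,J), X⟩ = d/dt F(g, J + tX)` at `t = 0`. -/
def d2 {n : ℕ} (F : Phase n → ℝ) (x : Phase n) : Mat n :=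
  dualMatrix fun X => deriv (fun t : ℝ => F (x.1, x.2 + t • X)) 0

/-- `∇₂F = J d₂F`. -/
def nabla2 {n : ℕ} (F : Phase n → ℝ) (x : Phase n) : Mat n := x.2 * d2 F x

/-- `∇₂'F = (d₂F) J`. -/
def nabla2' {n : ℕ} (F : Phase n → ℝ) (x : Phase n) : Mat n := d2 F x * x.2

/-- The first (canonical) Poisson bracket on `𝔐`. -/
def bracket1 {n : ℕ} (F H : Phase n → ℝ) : Phase n → ℝ := fun x =>
  pairing (nabla1 F x) (d2 H x) - pairing (nabla1 H x) (d2 F x)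
    + pairing x.2 (comm (d2 F x) (d2 H x))

/-- The second (quadratic) Poisson bracket on `𝔐`. -/
def bracket2 {n : ℕ} (F H : Phase n → ℝ) : Phase n → ℝ := fun x =>
  pairing (rMat (nabla1 F x)) (nabla1 H x) - pairing (rMat (nabla1' F x)) (nabla1' H x)
    + pairing (nabla2 F x - nabla2' F x) (rPlus (nabla2' H x) - rMinus (nabla2 H x))
    + pairing (nabla1 F x) (rPlus (nabla2' H x) - rMinus (nabla2 H x))
    - pairing (nabla1 H x) (rPlus (nabla2' F x) - rMinus (nabla2 F x))

/-- The ring `C^∞(𝔐)^{U(n) × U(n)}` of smooth functions invariant under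
`(g, J) ↦ (g η⁻¹, J)` and `(g, J) ↦ (η g, η J η⁻¹)` for all `η ∈ U(n)`. -/
def invariantRing (n : ℕ) : Subalgebra ℝ (Phase n → ℝ) where
  carrier := {F | SmoothOnPhase F ∧ ∀ η : unitary (Mat n), ∀ (g : GLn n) (J : Mat n),
    F (g * (Unitary.toUnits η)⁻¹, J) = F (g, J) ∧
    F (Unitary.toUnits η * g, (η : Mat n) * J * star (η : Mat n)) = F (g, J)}
  mul_mem' := by
    rintro F H ⟨⟨Φ, hΦ, eF⟩, iF⟩ ⟨⟨Ψ, hΨ, eH⟩, iH⟩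
    refine ⟨⟨fun p => Φ p * Ψ p, hΦ.mul hΨ, fun x => by simp [eF, eH]⟩, fun η g J => ?_⟩
    simp only [Pi.mul_apply]
    rw [(iF η g J).1, (iF η g J).2, (iH η g J).1, (iH η g J).2]
    exact ⟨rfl, rfl⟩
  add_mem' := by
    rintro F H ⟨⟨Φ, hΦ, eF⟩, iF⟩ ⟨⟨Ψ, hΨ, eH⟩, iH⟩
    refine ⟨⟨fun p => Φ p + Ψ p, hΦ.add hΨ, fun x => by simp [eF, eH]⟩, fun η g J => ?_⟩
    simp only [Pi.add_apply]
    rw [(iF η g J).1, (iF η g J).2, (iH η g J).1, (iH η g J).2]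
    exact ⟨rfl, rfl⟩
  algebraMap_mem' := fun c =>
    ⟨⟨fun _ => c, contDiffOn_const, fun _ => rfl⟩, fun _ _ _ => ⟨rfl, rfl⟩⟩

/-! ### The reduced space and the reduced ring of functions -/

/-- The open chamber `q₁ > q₂ > ⋯ > qₙ`. -/
abbrev Chamber (n : ℕ) : Type := {q : Fin n → ℝ // StrictAnti q}

/-- The manifold `𝔐₀^reg` of pairs `(e^q, J)`, parametrized by `(q, J)`. -/
abbrev RegSlice (n : ℕ) : Type := Chamber n × Mat n

/-- `f ∈ C^∞(𝔐₀^reg)`, where `𝔐₀^reg` is an open subset of `ℝⁿ × gl(n,ℂ)` via `(q, J)`. -/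
def SmoothOnSlice {n : ℕ} (f : RegSlice n → ℝ) : Prop :=
  ∃ φ : (Fin n → ℝ) × Mat n → ℝ, ContDiffOn ℝ ∞ φ {p | StrictAnti p.1} ∧
    ∀ x : RegSlice n, f x = φ (x.1, x.2)

/-- The ring `C^∞(𝔐₀^reg)^{𝕋ⁿ}` of smooth functions invariant under `(q, J) ↦ (q, τ J τ⁻¹)` for
all diagonal unitary matrices `τ`. -/
def torusInvariantRing (n : ℕ) : Subalgebra ℝ (RegSlice n → ℝ) where
  carrier := {f | SmoothOnSlice f ∧ ∀ τ : unitary (Mat n), (τ : Mat n).IsDiag →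
    ∀ (q : Chamber n) (J : Mat n), f (q, (τ : Mat n) * J * star (τ : Mat n)) = f (q, J)}
  mul_mem' := by
    rintro F H ⟨⟨Φ, hΦ, eF⟩, iF⟩ ⟨⟨Ψ, hΨ, eH⟩, iH⟩
    refine ⟨⟨fun p => Φ p * Ψ p, hΦ.mul hΨ, fun x => by simp [eF, eH]⟩, fun τ hτ q J => ?_⟩
    simp only [Pi.mul_apply]
    rw [iF τ hτ q J, iH τ hτ q J]
  add_mem' := by
    rintro F H ⟨⟨Φ, hΦ, eF⟩, iF⟩ ⟨⟨Ψ, hΨ, eH⟩, iH⟩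
    refine ⟨⟨fun p => Φ p + Ψ p, hΦ.add hΨ, fun x => by simp [eF, eH]⟩, fun τ hτ q J => ?_⟩
    simp only [Pi.add_apply]
    rw [iF τ hτ q J, iH τ hτ q J]
  algebraMap_mem' := fun c =>
    ⟨⟨fun _ => c, contDiffOn_const, fun _ => rfl⟩, fun _ _ _ _ => rfl⟩

/-- The embedding `ι : 𝔐₀^reg → 𝔐`, `(q, J) ↦ (diag(e^{q₁}, …, e^{qₙ}), J)`. -/
def incl {n : ℕ} (x : RegSlice n) : Phase n :=
  (expGL (Matrix.diagonal fun i => ((x.1 : Fin n → ℝ) i : ℂ)), x.2)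

/-- Restriction of functions `F ↦ F ∘ ι`, as a homomorphism of algebras. -/
def restrict (n : ℕ) : (Phase n → ℝ) →ₐ[ℝ] (RegSlice n → ℝ) where
  toFun F := fun x => F (incl x)
  map_one' := rfl
  map_mul' _ _ := rfl
  map_zero' := rfl
  map_add' _ _ := rfl
  commutes' _ := rfl

/-- The reduced ring `C^∞(𝔐)_red` of all `f ∈ C^∞(𝔐₀^reg)^{𝕋ⁿ}` of the form `f = F ∘ ι`
with `F ∈ C^∞(𝔐)^{U(n) × U(n)}`. -/
def reducedRing (n : ℕ) : Subalgebra ℝ (RegSlice n → ℝ) :=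
  torusInvariantRing n ⊓ (invariantRing n).map (restrict n)

/-! ### The reduced brackets -/

/-- The derivative `∇₁f`, a real diagonal matrix with
`⟨∇₁f(q,J), X₀⟩ = d/dt f(q + t X₀, J)` at `t = 0` for real diagonal `X₀`. Only values at small `t`
matter, for which `q + t X₀` is in the chamber; outside of it, `f` is extended by zero. -/
def redNabla1 {n : ℕ} (f : RegSlice n → ℝ) (x : RegSlice n) : Mat n :=
  Matrix.diagonal fun i =>
    ((deriv (fun t : ℝ => Function.extend Subtype.val (fun q : Chamber n => f (q, x.2)) 0
      ((x.1 : Fin n → ℝ) + t • Pi.single i (1 : ℝ))) 0 : ℝ) : ℂ)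

/-- `⟨d₂f(q,J), X⟩ = d/dt f(q, J + tX)` at `t = 0`. -/
def redD2 {n : ℕ} (f : RegSlice n → ℝ) (x : RegSlice n) : Mat n :=
  dualMatrix fun X => deriv (fun t : ℝ => f (x.1, x.2 + t • X)) 0

/-- `∇₂f = J d₂f`. -/
def redNabla2 {n : ℕ} (f : RegSlice n → ℝ) (x : RegSlice n) : Mat n := x.2 * redD2 f x

/-- `∇₂'f = (d₂f) J`. -/
def redNabla2' {n : ℕ} (f : RegSlice n → ℝ) (x : RegSlice n) : Mat n := redD2 f x * x.2

/-- The formula for the first reduced bracket. -/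
def redBracket1 {n : ℕ} (f h : RegSlice n → ℝ) : RegSlice n → ℝ := fun x =>
  pairing (redNabla1 f x) (diagPart (herm (redD2 h x)))
    - pairing (redNabla1 h x) (diagPart (herm (redD2 f x)))
    + pairing (dynR x.1 (aherm (comm (redD2 f x) x.2))) (herm (redD2 h x))
    - pairing (dynR x.1 (aherm (comm (redD2 h x) x.2))) (herm (redD2 f x))
    + pairing (aherm x.2)
        (comm (herm (redD2 f x)) (herm (redD2 h x))
          - comm (aherm (redD2 f x)) (aherm (redD2 h x)))

/-- The formula for the second reduced bracket. -/
def redBracket2 {n : ℕ} (f h : RegSlice n → ℝ) : RegSlice n → ℝ := fun x =>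
  (1 / 2 : ℝ) *
    (pairing (redNabla1 f x) (diagPart (herm (redNabla2 h x + redNabla2' h x)))
      - pairing (redNabla1 h x) (diagPart (herm (redNabla2 f x + redNabla2' f x)))
      + pairing (dynR x.1 (aherm (comm (redD2 f x) x.2))) (herm (redNabla2 h x + redNabla2' h x))
      - pairing (dynR x.1 (aherm (comm (redD2 h x) x.2))) (herm (redNabla2 f x + redNabla2' f x))
      + pairing (herm (redNabla2 f x)) (herm (redNabla2' h x))
      + pairing (aherm (redNabla2' f x)) (aherm (redNabla2 h x))
      - pairing (herm (redNabla2' f x)) (herm (redNabla2 h x))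
      - pairing (aherm (redNabla2 f x)) (aherm (redNabla2' h x)))

/-! ### The Hamiltonians -/

/-- `h_k = Re tr(J^k) / k`. -/
def hamRe (n k : ℕ) : RegSlice n → ℝ := fun x => (x.2 ^ k).trace.re / k

/-- `h̃_k = Im tr(J^k) / k`. -/
def hamIm (n k : ℕ) : RegSlice n → ℝ := fun x => (x.2 ^ k).trace.im / k

end SpinSutherland

end

open SpinSutherland

/-!
Write `⟨X, Y⟩ = Re tr (X Y)`, and at a point `(g, J)` of the phase space write `N = ∇₁F`, `D = d₂F`
and `Y = N + [J, D]`. Invariance of `F` under right multiplication by `U(n)` says that `∇₁'F`, which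
is conjugate to `N` by `g`, is Hermitian (`isHermitian_nabla1'`); invariance under the other action
says that `Y` is Hermitian (`isHermitian_nabla1_add_comm`). The operator `r` is antisymmetric and
maps Hermitian matrices to anti-Hermitian ones, and these two kinds of matrices are orthogonal.
Hence on invariant functions all terms with `r` in the second bracket cancel
(`bracket2_eq_pencil`), and `a {F, H}₁ + b {F, H}₂` becomes

  `⟨Y_F, K D_H⟩ - ⟨N_H, K D_F⟩` with `K X = a X + b/2 (J X + X J)`,

the bracket `pencil a b`. It is a biderivation, equivariant under the two actions, so it maps
invariant functions to invariant functions (`pencil_mem`). In the Jacobi sum the second derivatives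
of the functions cancel by their symmetry, and what remains is the derivative of the bivector along
the Hamiltonian vector fields, whose cyclic sum is `(b/2)² (⟨N₁, [N₂, N₃]⟩ - ⟨Y₁, [Y₂, Y₃]⟩)`
(`pencilVariation_cyclic_sum`). Both terms vanish, since the commutator of two Hermitian matrices is
anti-Hermitian and `N₁, N₂, N₃` are simultaneously conjugate to Hermitian matrices. This holds for
all `a` and `b`, which gives both Poisson brackets and their compatibility at once
(`isPoissonBracketOn_pencil`).

On the slice `g = e^q` the two Hermiticity conditions determine `N` up to a real diagonal part: its
anti-Hermitian part is that of `[D, J]`, and the off-diagonal part of its Hermitian part is `R(q)`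
applied to it (`herm_nabla1`), while its real diagonal holds the derivatives in `q`. Inserting
this into the brackets yields the reduced formulas (`redBracket1_restrict`,
`redBracket2_restrict`). Every restriction of an invariant function is torus invariant, so the
reduced ring is the image of the invariant ring, and all algebraic properties descend.

For the Hamiltonians `N = 0`, and `D` is a complex multiple of `J ^ (k - 1)`, which commutes with
`J`; involutivity and the recursion `K_{0,1} D_k = D_{k+1}` follow. Linear independence is seen from
the bracket of `tr (g g*)` with `Re tr J` at the points with `J = 0` and `J = 1`.
-/

noncomputable section

namespace SpinSutherland

/-! ### The trace form -/

section TraceForm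

variable {n : ℕ}

theorem pairing_add_left (X Y Z : Mat n) : pairing (X + Y) Z = pairing X Z + pairing Y Z := by
  simp [pairing, add_mul]

theorem pairing_add_right (X Y Z : Mat n) : pairing X (Y + Z) = pairing X Y + pairing X Z := by
  simp [pairing, mul_add]

theorem pairing_sub_left (X Y Z : Mat n) : pairing (X - Y) Z = pairing X Z - pairing Y Z := by
  simp [pairing, sub_mul]

theorem pairing_sub_right (X Y Z : Mat n) : pairing X (Y - Z) = pairing X Y - pairing X Z := by
  simp [pairing, mul_sub]

theorem pairing_neg_left (X Y : Mat n) : pairing (-X) Y = -pairing X Y := by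
  simp [pairing]

theorem pairing_neg_right (X Y : Mat n) : pairing X (-Y) = -pairing X Y := by
  simp [pairing]

theorem pairing_smul_left (c : ℝ) (X Y : Mat n) : pairing (c • X) Y = c * pairing X Y := by
  simp [pairing]

theorem pairing_smul_right (c : ℝ) (X Y : Mat n) : pairing X (c • Y) = c * pairing X Y := by
  simp [pairing]

@[simp]
theorem pairing_zero_left (X : Mat n) : pairing 0 X = 0 := by
  simp [pairing]

@[simp]
theorem pairing_zero_right (X : Mat n) : pairing X 0 = 0 := by
  simp [pairing]

theorem pairing_symm (X Y : Mat n) : pairing X Y = pairing Y X := by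
  rw [pairing, Matrix.trace_mul_comm, pairing]

theorem pairing_mul_left (X Y Z : Mat n) : pairing (X * Y) Z = pairing X (Y * Z) := by
  rw [pairing, mul_assoc, pairing]

theorem pairing_mul_cycle (X Y Z : Mat n) : pairing (X * Y) Z = pairing Y (Z * X) := by
  rw [pairing, pairing, mul_assoc, Matrix.trace_mul_comm, mul_assoc]

theorem pairing_comm_left (X Y Z : Mat n) : pairing (comm X Y) Z = pairing X (comm Y Z) := by
  rw [comm, comm, pairing_sub_left, pairing_sub_right, pairing_mul_left, pairing_mul_cycle]

theorem pairing_comm_right (X Y Z : Mat n) : pairing X (comm Y Z) = pairing Z (comm X Y) := by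
  rw [← pairing_comm_left, pairing_symm]

theorem comm_swap (X Y : Mat n) : comm X Y = -comm Y X := by
  simp [comm]

theorem dualMatrix_pairing (Y : Mat n) : dualMatrix (pairing Y) = Y := by
  ext i j
  apply Complex.ext <;>
    simp [dualMatrix, pairing, Matrix.trace_mul_single]

theorem eq_of_pairing_eq {Y Z : Mat n} (h : ∀ X, pairing Y X = pairing Z X) : Y = Z := by
  rw [← dualMatrix_pairing Y, ← dualMatrix_pairing Z, funext h]

theorem conj_mul_conj {U V : Mat n} (h : V * U = 1) (X Y : Mat n) :
    (U * X * V) * (U * Y * V) = U * (X * Y) * V := by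
  calc _ = U * X * (V * U) * Y * V := by noncomm_ring
    _ = _ := by rw [h]; noncomm_ring

theorem pairing_conj {U V : Mat n} (h : V * U = 1) (X Y : Mat n) :
    pairing (U * X * V) (U * Y * V) = pairing X Y := by
  rw [pairing, conj_mul_conj h, Matrix.trace_mul_comm, ← mul_assoc, h, one_mul, pairing]

theorem comm_conj {U V : Mat n} (h : V * U = 1) (X Y : Mat n) :
    comm (U * X * V) (U * Y * V) = U * comm X Y * V := by
  rw [comm, comm, conj_mul_conj h, conj_mul_conj h]
  noncomm_ring

end TraceForm

/-! ### Hermitian and anti-Hermitian parts -/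

section Hermitian

variable {n : ℕ}

theorem herm_add_aherm (X : Mat n) : herm X + aherm X = X := by
  rw [herm, aherm]
  module

theorem isHermitian_herm (X : Mat n) : (herm X).IsHermitian := by
  rw [Matrix.IsHermitian, herm]
  simp [add_comm]

theorem conjTranspose_aherm (X : Mat n) : (aherm X).conjTranspose = -aherm X := by
  rw [aherm]
  simp [← smul_neg]

theorem aherm_add (X Y : Mat n) : aherm (X + Y) = aherm X + aherm Y := by
  simp only [aherm, Matrix.conjTranspose_add]
  module

theorem aherm_sub (X Y : Mat n) : aherm (X - Y) = aherm X - aherm Y := by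
  simp only [aherm, Matrix.conjTranspose_sub]
  module

theorem aherm_neg (X : Mat n) : aherm (-X) = -aherm X := by
  simp only [aherm, Matrix.conjTranspose_neg]
  module

theorem aherm_eq_zero_iff {X : Mat n} : aherm X = 0 ↔ X.IsHermitian := by
  rw [aherm, smul_eq_zero, sub_eq_zero, Matrix.IsHermitian]
  simp [eq_comm]

theorem herm_eq_zero {X : Mat n} (h : X.conjTranspose = -X) : herm X = 0 := by
  rw [herm, h]
  simp

theorem aherm_of_conjTranspose_eq_neg {X : Mat n} (h : X.conjTranspose = -X) : aherm X = X := by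
  conv_rhs => rw [← herm_add_aherm X, herm_eq_zero h, zero_add]

/-- Hermitian and anti-Hermitian matrices are orthogonal for the real trace form. -/
theorem pairing_eq_zero {X Y : Mat n} (hX : X.IsHermitian) (hY : Y.conjTranspose = -Y) :
    pairing X Y = 0 := by
  have h : pairing X Y = -pairing X Y := by
    conv_lhs => rw [pairing, ← Complex.conj_re, ← Complex.star_def, ← Matrix.trace_conjTranspose,
      Matrix.conjTranspose_mul, hX.eq, hY, Matrix.trace_mul_comm]
    rw [← pairing_neg_right, pairing]
  linarith

theorem pairing_herm_aherm (X Y : Mat n) : pairing (herm X) (aherm Y) = 0 :=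
  pairing_eq_zero (isHermitian_herm X) (conjTranspose_aherm Y)

theorem pairing_eq_herm_add_aherm (X Y : Mat n) :
    pairing X Y = pairing (herm X) (herm Y) + pairing (aherm X) (aherm Y) := by
  conv_lhs => rw [← herm_add_aherm X, ← herm_add_aherm Y]
  rw [pairing_add_left, pairing_add_right, pairing_add_right, pairing_herm_aherm,
    pairing_symm (aherm X) (herm Y), pairing_herm_aherm]
  ring

theorem pairing_aherm_left (X Y : Mat n) : pairing (aherm X) Y = pairing X (aherm Y) := by
  conv_lhs => rw [← herm_add_aherm Y]
  conv_rhs => rw [← herm_add_aherm X]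
  rw [pairing_add_left, pairing_add_right, pairing_herm_aherm,
    pairing_symm (aherm X) (herm Y), pairing_herm_aherm]

theorem eq_zero_of_pairing_conjTranspose_self {X : Mat n} (h : pairing X X.conjTranspose = 0) :
    X = 0 := by
  open scoped ComplexOrder in
  rw [← Matrix.trace_mul_conjTranspose_self_eq_zero_iff]
  refine Complex.ext h (Complex.conj_eq_iff_im.1 ?_)
  rw [← Complex.star_def, ← Matrix.trace_conjTranspose, Matrix.conjTranspose_mul,
    Matrix.conjTranspose_conjTranspose]

/-- The trace form is negative definite on the anti-Hermitian matrices, so the orthogonal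
complement of `u(n)` is the space of Hermitian matrices. -/
theorem isHermitian_of_pairing_eq_zero {X : Mat n}
    (h : ∀ Y : Mat n, Y.conjTranspose = -Y → pairing X Y = 0) : X.IsHermitian := by
  have h1 := h (aherm X) (conjTranspose_aherm X)
  rw [← aherm_eq_zero_iff]
  apply eq_zero_of_pairing_conjTranspose_self
  rw [conjTranspose_aherm, pairing_neg_right, pairing_aherm_left,
    aherm_of_conjTranspose_eq_neg (conjTranspose_aherm X), h1, neg_zero]

theorem conjTranspose_comm {X Y : Mat n} (hX : X.IsHermitian) (hY : Y.IsHermitian) :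
    (comm X Y).conjTranspose = -comm X Y := by
  simp [comm, hX.eq, hY.eq]

/-- The trilinear form `⟨X, [Y, Z]⟩` vanishes on Hermitian matrices. -/
theorem pairing_comm_eq_zero {X Y Z : Mat n} (hX : X.IsHermitian) (hY : Y.IsHermitian)
    (hZ : Z.IsHermitian) : pairing X (comm Y Z) = 0 :=
  pairing_eq_zero hX (conjTranspose_comm hY hZ)

end Hermitian

/-! ### The classical `r`-matrix -/

section RMatrix

variable {n : ℕ}

theorem rMat_sub (X Y : Mat n) : rMat (X - Y) = rMat X - rMat Y := by
  ext i j
  simp only [rMat, Matrix.of_apply, Matrix.sub_apply]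
  split_ifs <;> ring

theorem pairing_rMat (X Y : Mat n) : pairing (rMat X) Y = -pairing X (rMat Y) := by
  simp only [pairing, Matrix.trace, Matrix.diag, Matrix.mul_apply, rMat, Matrix.of_apply,
    Complex.re_sum, ← Finset.sum_neg_distrib]
  refine Finset.sum_congr rfl fun i _ => Finset.sum_congr rfl fun j _ => ?_
  rcases lt_trichotomy i j with h | h | h
  · rw [if_pos h, if_neg h.not_gt, if_pos h, ← Complex.neg_re]
    ring_nf
  · subst h
    simp
  · rw [if_pos h, if_neg h.not_gt, if_pos h, ← Complex.neg_re]
    ring_nf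

theorem conjTranspose_rMat {X : Mat n} (h : X.IsHermitian) : (rMat X).conjTranspose = -rMat X := by
  ext i j
  rw [Matrix.conjTranspose_apply, Matrix.neg_apply]
  simp only [rMat, Matrix.of_apply]
  have hij := h.apply i j
  rcases lt_trichotomy i j with h | h | h
  · rw [if_pos h, if_neg h.not_gt, if_pos h, star_div₀, star_neg, hij]
    simp [neg_div]
  · subst h
    simp
  · rw [if_pos h, if_neg h.not_gt, if_pos h, star_div₀, hij]
    simp [neg_div]

/-- `r` maps Hermitian matrices to anti-Hermitian ones, so its form vanishes on them. -/
theorem pairing_rMat_eq_zero {X Y : Mat n} (hX : X.IsHermitian) (hY : Y.IsHermitian) :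
    pairing (rMat X) Y = 0 := by
  rw [pairing_symm]
  exact pairing_eq_zero hY (conjTranspose_rMat hX)

end RMatrix

/-! ### The pencil of bivectors -/

section Pencil

variable {n : ℕ}

/-- The operator `X ↦ a X + b/2 (J X + X J)`, which is self-adjoint for the trace form. -/
def pencilOp (a b : ℝ) (J X : Mat n) : Mat n := a • X + (b / 2) • (J * X + X * J)

/-- The bivector `a P₁ + b P₂` at a point with second component `J`, evaluated on two covectors
with components `Nᵢ` (left translated to the unit of the group) and `Dᵢ`. -/
def pencilForm (a b : ℝ) (J N₁ D₁ N₂ D₂ : Mat n) : ℝ :=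
  pairing (N₁ + comm J D₁) (pencilOp a b J D₂) - pairing N₂ (pencilOp a b J D₁)

theorem pairing_pencilOp (a b : ℝ) (J X Y : Mat n) :
    pairing (pencilOp a b J X) Y = pairing X (pencilOp a b J Y) := by
  simp only [pencilOp, pairing_add_left, pairing_add_right, pairing_smul_left, pairing_smul_right,
    pairing_mul_left, pairing_mul_cycle J X Y]
  ring

theorem pairing_anticomm (X Y Z : Mat n) :
    pairing X (Y * Z + Z * Y) = pairing Y (X * Z + Z * X) := by
  rw [pairing_symm, pairing_add_left, pairing_mul_left, pairing_mul_cycle, pairing_add_right,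
    add_comm]

theorem pencilForm_antisymm (a b : ℝ) (J N₁ D₁ N₂ D₂ : Mat n) :
    pencilForm a b J N₁ D₁ N₂ D₂ = -pencilForm a b J N₂ D₂ N₁ D₁ := by
  have h : ∀ X Y : Mat n, pairing (comm J X) (pencilOp a b J Y)
      = a * pairing J (comm X Y) + b / 2 * pairing (J * J) (comm X Y) := by
    intro X Y
    have e1 : comm X (pencilOp a b J Y) = a • comm X Y
        + (b / 2) • (X * J * Y - Y * J * X + (X * Y * J - J * Y * X)) := by
      simp only [pencilOp, comm, mul_add, add_mul, smul_mul_assoc, mul_smul_comm, mul_assoc]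
      module
    rw [pairing_comm_left, e1, pairing_add_right, pairing_smul_right, pairing_smul_right,
      pairing_mul_left J J]
    congr 2
    simp only [comm, mul_sub, pairing_sub_right, pairing_add_right]
    have e2 : pairing J (X * J * Y) = pairing J (Y * J * X) := by
      rw [pairing_symm, mul_assoc, pairing_mul_cycle, pairing_mul_left]
      simp only [mul_assoc]
    have e3 : pairing J (X * Y * J) = pairing J (J * (X * Y)) := by
      rw [pairing_symm, pairing_mul_cycle]
    rw [e2, e3, mul_assoc J Y X]
    ring
  rw [pencilForm, pencilForm, pairing_add_left, pairing_add_left, h, h, comm_swap D₂ D₁,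
    pairing_neg_right, pairing_neg_right]
  ring

/-- The derivative of `pencilForm a b J N₂ D₂ N₃ D₃` along the Hamiltonian vector field of a
covector `(N₁, D₁)`: under it `J` moves with velocity `pencilOp a b J (N₁ + [J, D₁])` and
`Nᵢ = g Aᵢ` with velocity `-pencilOp a b J D₁ * Nᵢ`, while `Aᵢ`
and `Dᵢ` are constant. -/
def pencilVariation (a b : ℝ) (J N₁ D₁ N₂ D₂ N₃ D₃ : Mat n) : ℝ :=
  let Z := pencilOp a b J D₁
  let V := pencilOp a b J (N₁ + comm J D₁)
  pairing (-(Z * N₂) + comm V D₂) (pencilOp a b J D₃)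
    + pairing (N₂ + comm J D₂) ((b / 2) • (V * D₃ + D₃ * V))
    - (pairing (-(Z * N₃)) (pencilOp a b J D₂) + pairing N₃ ((b / 2) • (V * D₂ + D₂ * V)))

/-- The Schouten bracket of `a P₁ + b P₂` with itself: the failure of the Jacobi identity is
a multiple of the difference of the trilinear forms `⟨Y₁, [Y₂, Y₃]⟩` and `⟨N₁, [N₂, N₃]⟩`,
where `Yᵢ = Nᵢ + [J, Dᵢ]`. -/
theorem pencilVariation_cyclic_sum (a b : ℝ) (J N₁ D₁ N₂ D₂ N₃ D₃ : Mat n) :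
    pencilVariation a b J N₁ D₁ N₂ D₂ N₃ D₃ + pencilVariation a b J N₂ D₂ N₃ D₃ N₁ D₁
      + pencilVariation a b J N₃ D₃ N₁ D₁ N₂ D₂
    = (b / 2) ^ 2 * (pairing N₁ (comm N₂ N₃)
        - pairing (N₁ + comm J D₁) (comm (N₂ + comm J D₂) (N₃ + comm J D₃))) := by
  -- Every trace is linear in `(N₁, D₁)`, and cyclicity moves this factor to the front. The identity
  -- then says that the cofactors of `N₁` and of `D₁` vanish (`f1` and `f2` below).
  have split : ∀ W : Mat n, pairing (N₁ + comm J D₁) W = pairing N₁ W + pairing D₁ (comm W J) := by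
    intro W
    rw [pairing_add_left, pairing_comm_left, pairing_comm_right, pairing_comm_right]
  obtain ⟨Y₂, hY₂⟩ : ∃ Y, Y = N₂ + comm J D₂ := ⟨_, rfl⟩
  obtain ⟨Y₃, hY₃⟩ : ∃ Y, Y = N₃ + comm J D₃ := ⟨_, rfl⟩
  obtain ⟨Y₁, hY₁⟩ : ∃ Y, Y = N₁ + comm J D₁ := ⟨_, rfl⟩
  obtain ⟨K, hK⟩ : ∃ K, K = pencilOp a b J := ⟨_, rfl⟩
  obtain ⟨c, hc⟩ : ∃ c, c = b / 2 := ⟨_, rfl⟩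
  have hself : ∀ X Y : Mat n, pairing (K X) Y = pairing X (K Y) := fun X Y => by
    rw [hK, pairing_pencilOp]
  have e1 : pencilVariation a b J N₁ D₁ N₂ D₂ N₃ D₃ =
      pairing Y₁ (K (comm D₂ (K D₃) + c • (Y₂ * D₃ + D₃ * Y₂) - c • (N₃ * D₂ + D₂ * N₃)))
      + pairing D₁ (K (N₃ * K D₂ - N₂ * K D₃)) := by
    rw [← hself, ← hself]
    simp only [pencilVariation, ← hK, ← hc, ← hY₁, ← hY₂, pairing_add_left, pairing_neg_left,
      pairing_comm_left, pairing_mul_left, pairing_add_right, pairing_sub_right,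
      pairing_smul_right]
    simp only [← pairing_add_right, pairing_anticomm _ (K Y₁)]
    ring
  have e2 : pencilVariation a b J N₂ D₂ N₃ D₃ N₁ D₁ =
      pairing N₁ (K D₃ * K D₂ - c • (K Y₂ * D₃ + D₃ * K Y₂))
      + pairing D₁ (K (comm (K Y₂) D₃ - K D₂ * N₃) + c • (Y₃ * K Y₂ + K Y₂ * Y₃)) := by
    rw [pairing_add_right D₁, ← hself]
    simp only [pencilVariation, ← hK, ← hc, ← hY₂, ← hY₃, ← neg_mul]
    rw [pairing_symm _ (K D₁), pairing_mul_cycle (-(K D₂)) N₁, pairing_smul_right,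
      pairing_smul_right, add_comm (K Y₂ * D₁), pairing_anticomm Y₃ D₁]
    simp only [pairing_add_right, pairing_sub_right, pairing_smul_right, mul_neg, neg_mul,
      pairing_neg_right]
    ring
  have e3 : pencilVariation a b J N₃ D₃ N₁ D₁ N₂ D₂ =
      pairing Y₁ (c • (K Y₃ * D₂ + D₂ * K Y₃)) - pairing N₁ (K D₂ * K D₃)
      + pairing D₁ (comm (K D₂) (K Y₃) + K (K D₃ * N₂) - c • (N₂ * K Y₃ + K Y₃ * N₂)) := by
    rw [pairing_sub_right D₁, pairing_add_right D₁, ← hself D₁, pairing_comm_right D₁]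
    simp only [pencilVariation, ← hK, ← hc, ← hY₃, ← hY₁, ← neg_mul]
    rw [pairing_smul_right, pairing_smul_right, pairing_smul_right, add_comm (K Y₃ * D₁),
      pairing_anticomm N₂ D₁, pairing_add_left, pairing_mul_cycle (-(K D₃)) N₁,
      pairing_symm (-(K D₃) * N₂), pairing_comm_left]
    simp only [pairing_add_right, mul_neg, neg_mul,
      pairing_neg_right]
    ring
  obtain ⟨W, hW⟩ : ∃ W, W = K (comm D₂ (K D₃) + c • (Y₂ * D₃ + D₃ * Y₂)
      - c • (N₃ * D₂ + D₂ * N₃)) + c • (K Y₃ * D₂ + D₂ * K Y₃) + c ^ 2 • comm Y₂ Y₃ := ⟨_, rfl⟩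
  have f1 : W + (K D₃ * K D₂ - c • (K Y₂ * D₃ + D₃ * K Y₂)) - K D₂ * K D₃
      - c ^ 2 • comm N₂ N₃ = 0 := by
    rw [hW, hK, hY₂, hY₃]
    simp only [pencilOp, ← hc, comm, mul_add, add_mul, mul_sub, sub_mul, smul_mul_assoc,
      mul_smul_comm, mul_assoc]
    module
  have f2 : comm W J + K (N₃ * K D₂ - N₂ * K D₃)
      + (K (comm (K Y₂) D₃ - K D₂ * N₃) + c • (Y₃ * K Y₂ + K Y₂ * Y₃))
      + (comm (K D₂) (K Y₃) + K (K D₃ * N₂) - c • (N₂ * K Y₃ + K Y₃ * N₂)) = 0 := by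
    rw [hW, hK, hY₂, hY₃]
    simp only [pencilOp, ← hc, comm, mul_add, add_mul, mul_sub, sub_mul, smul_mul_assoc,
      mul_smul_comm, mul_assoc]
    module
  have g1 := congrArg (pairing N₁) f1
  have g2 := congrArg (pairing D₁) f2
  have g3 := split W
  rw [← hY₁, ← hY₂, ← hY₃, ← hc, e1, e2, e3]
  rw [← hY₁] at g3
  rw [hW] at g1 g2 g3
  simp only [pairing_add_right, pairing_sub_right, pairing_smul_right, pairing_zero_right]
    at g1 g2 g3 ⊢
  linear_combination g1 + g2 + g3

end Pencil

/-! ### Smooth functions on the phase space and their gradients -/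

section Calculus

variable {n : ℕ}

/-- The linear functional `Re tr` as a continuous linear map. -/
def reTrace (n : ℕ) : Mat n →L[ℝ] ℝ :=
  LinearMap.toContinuousLinearMap
    { toFun := fun X => X.trace.re
      map_add' := fun X Y => by simp
      map_smul' := fun c X => by simp }

theorem _root_.HasDerivAt.pairing {f g : ℝ → Mat n} {f' g' : Mat n} {t : ℝ} (hf : HasDerivAt f f' t)
    (hg : HasDerivAt g g' t) :
    HasDerivAt (fun s => SpinSutherland.pairing (f s) (g s))
      (SpinSutherland.pairing f' (g t) + SpinSutherland.pairing (f t) g') t := by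
  have h := (reTrace n).hasFDerivAt.comp_hasDerivAt t (hf.mul hg)
  exact h.congr_deriv ((reTrace n).map_add _ _)

theorem _root_.ContDiffOn.pairing {E : Type*} [NormedAddCommGroup E] [NormedSpace ℝ E]
    {f g : E → Mat n} {s : Set E} (hf : ContDiffOn ℝ ∞ f s) (hg : ContDiffOn ℝ ∞ g s) :
    ContDiffOn ℝ ∞ (fun p => SpinSutherland.pairing (f p) (g p)) s :=
  (reTrace n).contDiff.comp_contDiffOn (hf.mul hg)

theorem dualMatrix_eq_sum (ℓ : Mat n → ℝ) :
    dualMatrix ℓ = ∑ i, ∑ j, (ℓ (Matrix.single j i 1) • (Matrix.single i j 1 : Mat n)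
      + ℓ (Matrix.single j i Complex.I) • (Matrix.single i j (-Complex.I) : Mat n)) := by
  rw [Matrix.matrix_eq_sum_single (dualMatrix ℓ)]
  refine Finset.sum_congr rfl fun i _ => Finset.sum_congr rfl fun j _ => ?_
  rw [Matrix.smul_single, Matrix.smul_single, ← Matrix.single_add]
  congr 1
  simp [dualMatrix]
  ring

theorem hasDerivAt_dualMatrix {ℓ : ℝ → Mat n → ℝ} {ℓ' : Mat n → ℝ} {t : ℝ}
    (h : ∀ X, HasDerivAt (fun s => ℓ s X) (ℓ' X) t) :
    HasDerivAt (fun s => dualMatrix (ℓ s)) (dualMatrix ℓ') t := by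
  simp only [dualMatrix_eq_sum]
  exact HasDerivAt.fun_sum fun i _ => HasDerivAt.fun_sum fun j _ =>
    ((h _).smul_const _).add ((h _).smul_const _)

theorem contDiffOn_dualMatrix {E : Type*} [NormedAddCommGroup E] [NormedSpace ℝ E]
    {ℓ : E → Mat n → ℝ} {s : Set E} (h : ∀ X, ContDiffOn ℝ ∞ (fun p => ℓ p X) s) :
    ContDiffOn ℝ ∞ (fun p => dualMatrix (ℓ p)) s := by
  simp only [dualMatrix_eq_sum]
  exact ContDiffOn.sum fun i _ => ContDiffOn.sum fun j _ =>
    ((h _).smul contDiffOn_const).add ((h _).smul contDiffOn_const)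

/-- The matrix `A` with `ℓ (X, 0) = ⟨A, X⟩`, for a covector `ℓ` of the phase space. -/
def gradFst (ℓ : Mat n × Mat n → ℝ) : Mat n := dualMatrix fun X => ℓ (X, 0)

/-- The matrix `D` with `ℓ (0, X) = ⟨D, X⟩`, for a covector `ℓ` of the phase space. -/
def gradSnd (ℓ : Mat n × Mat n → ℝ) : Mat n := dualMatrix fun X => ℓ (0, X)

theorem pairing_gradFst (ℓ : Mat n × Mat n →ₗ[ℝ] ℝ) (X : Mat n) :
    pairing (gradFst ℓ) X = ℓ (X, 0) :=
  pairing_dualMatrix (ℓ ∘ₗ LinearMap.inl ℝ (Mat n) (Mat n)) X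

theorem pairing_gradSnd (ℓ : Mat n × Mat n →ₗ[ℝ] ℝ) (X : Mat n) :
    pairing (gradSnd ℓ) X = ℓ (0, X) :=
  pairing_dualMatrix (ℓ ∘ₗ LinearMap.inr ℝ (Mat n) (Mat n)) X

theorem covector_apply (ℓ : Mat n × Mat n →ₗ[ℝ] ℝ) (u v : Mat n) :
    ℓ (u, v) = pairing (gradFst ℓ) u + pairing (gradSnd ℓ) v := by
  rw [pairing_gradFst, pairing_gradSnd, ← map_add, Prod.mk_add_mk, add_zero, zero_add]

/-- The differential of a function as a linear map; forgetting its continuity avoids a topology on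
the space of covectors. -/
def differential {E : Type*} [NormedAddCommGroup E] [NormedSpace ℝ E] (f : E → ℝ) (x : E) :
    E →ₗ[ℝ] ℝ := fderiv ℝ f x

/-- The derivative of the differential of a function in the direction `w`, as a linear map. -/
def secondDiff {E : Type*} [NormedAddCommGroup E] [NormedSpace ℝ E] (f : E → ℝ) (x w : E) :
    E →ₗ[ℝ] ℝ := (fderiv ℝ (fderiv ℝ f) x w : E →L[ℝ] ℝ)

section Differential

variable {E : Type*} [NormedAddCommGroup E] [NormedSpace ℝ E] {f : E → ℝ} {x : E}

theorem secondDiff_symm (h : ContDiffAt ℝ ∞ f x) (v w : E) :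
    secondDiff f x v w = secondDiff f x w v :=
  h.isSymmSndFDerivAt (by simpa using WithTop.coe_le_coe.2 (le_top : (2 : ℕ∞) ≤ ⊤)) v w

theorem hasDerivAt_comp (h : ContDiffAt ℝ ∞ f x) {γ : ℝ → E} {w : E} (hγ : HasDerivAt γ w 0)
    (h0 : γ 0 = x) : HasDerivAt (fun t => f (γ t)) (differential f x w) 0 :=
  (h.differentiableAt (by simp)).hasFDerivAt.comp_hasDerivAt_of_eq (0 : ℝ) hγ h0.symm

theorem hasDerivAt_differential (h : ContDiffAt ℝ ∞ f x) {γ : ℝ → E} {w : E}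
    (hγ : HasDerivAt γ w 0) (h0 : γ 0 = x) (u : E) :
    HasDerivAt (fun t => differential f (γ t) u) (secondDiff f x w u) 0 := by
  have h1 : ContDiffAt ℝ ∞ (fderiv ℝ f) x := h.fderiv_right (by simp)
  have h2 := (h1.differentiableAt (by simp)).hasFDerivAt.comp_hasDerivAt_of_eq (0 : ℝ) hγ h0.symm
  exact ((ContinuousLinearMap.apply ℝ ℝ u).hasFDerivAt.comp_hasDerivAt (0 : ℝ) h2)

theorem contDiffOn_differential {s : Set E} (hs : IsOpen s) (h : ContDiffOn ℝ ∞ f s) (u : E) :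
    ContDiffOn ℝ ∞ (fun p => differential f p u) s :=
  (ContinuousLinearMap.apply ℝ ℝ u).contDiff.comp_contDiffOn (h.fderiv_of_isOpen hs (by simp))

end Differential

/-- The open set of pairs of matrices of which the first one is invertible. -/
def unitPairs (n : ℕ) : Set (Mat n × Mat n) := {p | IsUnit p.1}

theorem isOpen_unitPairs : IsOpen (unitPairs n) :=
  Units.isOpen.preimage continuous_fst

/-- A point of the phase space as a pair of matrices. -/
def Phase.toPair (x : Phase n) : Mat n × Mat n := (x.1, x.2)

theorem Phase.toPair_mem (x : Phase n) : x.toPair ∈ unitPairs n := x.1.isUnit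

/-- `Φ` is a smooth function on the open set of pairs `(g, J)` with `g` invertible that
represents the function `F` on the phase space. -/
def Extends (Φ : Mat n × Mat n → ℝ) (F : Phase n → ℝ) : Prop :=
  ContDiffOn ℝ ∞ Φ (unitPairs n) ∧ ∀ x : Phase n, F x = Φ x.toPair

variable {Φ Ψ Χ : Mat n × Mat n → ℝ} {F G H : Phase n → ℝ}

theorem Extends.contDiffAt (h : Extends Φ F) (x : Phase n) : ContDiffAt ℝ ∞ Φ x.toPair :=
  h.1.contDiffAt (isOpen_unitPairs.mem_nhds x.toPair_mem)

/-- The chain rule along a curve in the phase space. -/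
theorem Extends.hasDerivAt (h : Extends Φ F) {c : ℝ → Phase n} {u v : Mat n} {x : Phase n}
    (hx : c 0 = x) (hu : HasDerivAt (fun t => ((c t).1 : Mat n)) u 0)
    (hv : HasDerivAt (fun t => (c t).2) v 0) :
    HasDerivAt (fun t => F (c t)) (differential Φ x.toPair (u, v)) 0 := by
  subst hx
  have h1 := hasDerivAt_comp (h.contDiffAt (c 0)) (hu.prodMk hv) rfl
  exact h1.congr_of_eventuallyEq (Filter.Eventually.of_forall fun t => h.2 (c t))

theorem coe_expGL (X : Mat n) : ((expGL X : GLn n) : Mat n) = NormedSpace.exp X := rfl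

theorem expGL_zero : (expGL (0 : Mat n)) = 1 := by
  ext1
  rw [coe_expGL, NormedSpace.exp_zero, Units.val_one]

theorem hasDerivAt_expGL (X : Mat n) :
    HasDerivAt (fun t : ℝ => ((expGL (t • X) : GLn n) : Mat n)) X 0 := by
  have h := hasDerivAt_exp_smul_const (𝕂 := ℝ) X 0
  rw [zero_smul, NormedSpace.exp_zero, one_mul] at h
  exact h

theorem Extends.hasDerivAt_left (h : Extends Φ F) (x : Phase n) (X : Mat n) :
    HasDerivAt (fun t : ℝ => F (expGL (t • X) * x.1, x.2))
      (differential Φ x.toPair (X * x.1, 0)) 0 :=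
  h.hasDerivAt (by simp [expGL_zero]) ((hasDerivAt_expGL X).mul_const (x.1 : Mat n))
    (hasDerivAt_const 0 x.2)

theorem Extends.hasDerivAt_right (h : Extends Φ F) (x : Phase n) (X : Mat n) :
    HasDerivAt (fun t : ℝ => F (x.1 * expGL (t • X), x.2))
      (differential Φ x.toPair (x.1 * X, 0)) 0 :=
  h.hasDerivAt (by simp [expGL_zero]) ((hasDerivAt_expGL X).const_mul (x.1 : Mat n))
    (hasDerivAt_const 0 x.2)

theorem Extends.hasDerivAt_snd (h : Extends Φ F) (x : Phase n) (X : Mat n) :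
    HasDerivAt (fun t : ℝ => F (x.1, x.2 + t • X)) (differential Φ x.toPair (0, X)) 0 := by
  refine h.hasDerivAt (by simp) (hasDerivAt_const 0 (x.1 : Mat n)) ?_
  have h1 := ((hasDerivAt_id (0 : ℝ)).smul_const X).const_add x.2
  rw [one_smul] at h1
  exact h1

theorem Extends.nabla1_eq (h : Extends Φ F) (x : Phase n) :
    nabla1 F x = x.1 * gradFst (differential Φ x.toPair) := by
  rw [← dualMatrix_pairing (_ * _), nabla1]
  congr 1
  ext X
  rw [(h.hasDerivAt_left x X).deriv, ← pairing_gradFst, pairing_mul_cycle]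

theorem Extends.nabla1'_eq (h : Extends Φ F) (x : Phase n) :
    nabla1' F x = gradFst (differential Φ x.toPair) * x.1 := by
  rw [← dualMatrix_pairing (_ * _), nabla1']
  congr 1
  ext X
  rw [(h.hasDerivAt_right x X).deriv, ← pairing_gradFst, pairing_mul_left]

theorem Extends.d2_eq (h : Extends Φ F) (x : Phase n) :
    d2 F x = gradSnd (differential Φ x.toPair) := by
  rw [← dualMatrix_pairing (gradSnd _), d2]
  congr 1
  ext X
  rw [(h.hasDerivAt_snd x X).deriv, ← pairing_gradSnd]

theorem Extends.pairing_nabla1 (h : Extends Φ F) (x : Phase n) (X : Mat n) :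
    pairing (nabla1 F x) X = differential Φ x.toPair (X * x.1, 0) := by
  rw [h.nabla1_eq, pairing_mul_cycle, pairing_gradFst]

theorem Extends.pairing_nabla1' (h : Extends Φ F) (x : Phase n) (X : Mat n) :
    pairing (nabla1' F x) X = differential Φ x.toPair (x.1 * X, 0) := by
  rw [h.nabla1'_eq, pairing_mul_left, pairing_gradFst]

theorem Extends.pairing_d2 (h : Extends Φ F) (x : Phase n) (X : Mat n) :
    pairing (d2 F x) X = differential Φ x.toPair (0, X) := by
  rw [h.d2_eq, pairing_gradSnd]

theorem Extends.add (hF : Extends Φ F) (hG : Extends Ψ G) : Extends (Φ + Ψ) (F + G) :=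
  ⟨hF.1.add hG.1, fun x => by simp [hF.2, hG.2]⟩

theorem Extends.mul (hF : Extends Φ F) (hG : Extends Ψ G) : Extends (Φ * Ψ) (F * G) :=
  ⟨hF.1.mul hG.1, fun x => by simp [hF.2, hG.2]⟩

theorem Extends.smul (c : ℝ) (hF : Extends Φ F) : Extends (c • Φ) (c • F) :=
  ⟨hF.1.const_smul c, fun x => by simp [hF.2]⟩

end Calculus

/-! ### The pencil of brackets -/

section PencilBracket

variable {n : ℕ} {Φ Ψ Χ : Mat n × Mat n → ℝ} {F G H : Phase n → ℝ}

/-- The bracket of the bivector `pencilForm a b` on functions on the phase space. -/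
def pencil (a b : ℝ) (F H : Phase n → ℝ) : Phase n → ℝ := fun x =>
  pencilForm a b x.2 (nabla1 F x) (d2 F x) (nabla1 H x) (d2 H x)

/-- The bracket `pencil a b` in terms of smooth functions on pairs of matrices. -/
def pencilPair (a b : ℝ) (Φ Ψ : Mat n × Mat n → ℝ) : Mat n × Mat n → ℝ := fun p =>
  pencilForm a b p.2 (p.1 * gradFst (differential Φ p)) (gradSnd (differential Φ p))
    (p.1 * gradFst (differential Ψ p)) (gradSnd (differential Ψ p))

theorem contDiffOn_pencilPair (a b : ℝ) (hΦ : ContDiffOn ℝ ∞ Φ (unitPairs n))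
    (hΨ : ContDiffOn ℝ ∞ Ψ (unitPairs n)) :
    ContDiffOn ℝ ∞ (pencilPair a b Φ Ψ) (unitPairs n) := by
  have h1 : ContDiffOn ℝ ∞ (fun p : Mat n × Mat n => p.1) (unitPairs n) := contDiffOn_fst
  have h2 : ContDiffOn ℝ ∞ (fun p : Mat n × Mat n => p.2) (unitPairs n) := contDiffOn_snd
  have hA : ∀ {Φ}, ContDiffOn ℝ ∞ Φ (unitPairs n) →
      ContDiffOn ℝ ∞ (fun p => p.1 * gradFst (differential Φ p)) (unitPairs n) := fun hΦ =>
    h1.mul (contDiffOn_dualMatrix fun _ => contDiffOn_differential isOpen_unitPairs hΦ _)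
  have hD : ∀ {Φ}, ContDiffOn ℝ ∞ Φ (unitPairs n) →
      ContDiffOn ℝ ∞ (fun p => gradSnd (differential Φ p)) (unitPairs n) := fun hΦ =>
    contDiffOn_dualMatrix fun _ => contDiffOn_differential isOpen_unitPairs hΦ _
  have hK : ∀ {D : Mat n × Mat n → Mat n}, ContDiffOn ℝ ∞ D (unitPairs n) →
      ContDiffOn ℝ ∞ (fun p => pencilOp a b p.2 (D p)) (unitPairs n) := fun hD =>
    (hD.const_smul a).add (((h2.mul hD).add (hD.mul h2)).const_smul (b / 2))
  exact (((hA hΦ).add ((h2.mul (hD hΦ)).sub ((hD hΦ).mul h2))).pairing (hK (hD hΨ))).sub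
    ((hA hΨ).pairing (hK (hD hΦ)))

theorem Extends.pencil (a b : ℝ) (hF : Extends Φ F) (hH : Extends Ψ H) :
    Extends (pencilPair a b Φ Ψ) (pencil a b F H) :=
  ⟨contDiffOn_pencilPair a b hF.1 hH.1, fun x => by
    rw [SpinSutherland.pencil, pencilPair, hF.nabla1_eq, hF.d2_eq, hH.nabla1_eq, hH.d2_eq]
    rfl⟩

/-- The value at `(g, J)` of the Hamiltonian vector field of a covector with components
`N` and `D`. -/
def hamField (a b : ℝ) (p : Mat n × Mat n) (N D : Mat n) : Mat n × Mat n :=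
  (-(pencilOp a b p.2 D) * p.1, pencilOp a b p.2 (N + comm p.2 D))

theorem pencilForm_eq_hamField (a b : ℝ) (p : Mat n × Mat n) (N D : Mat n)
    (ℓ : Mat n × Mat n →ₗ[ℝ] ℝ) :
    pencilForm a b p.2 N D (p.1 * gradFst ℓ) (gradSnd ℓ) = ℓ (hamField a b p N D) := by
  rw [hamField, covector_apply, pencilForm, pairing_mul_cycle p.1, neg_mul, pairing_neg_right,
    ← pairing_pencilOp, pairing_symm (gradSnd ℓ)]
  ring

theorem Extends.pencil_eq (a b : ℝ) (hH : Extends Ψ H) (x : Phase n) :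
    SpinSutherland.pencil a b F H x
      = differential Ψ x.toPair (hamField a b x.toPair (nabla1 F x) (d2 F x)) := by
  rw [← pencilForm_eq_hamField, SpinSutherland.pencil, hH.nabla1_eq, hH.d2_eq]
  rfl

theorem hasDerivAt_pencilForm (a b : ℝ) {g J A₁ D₁ A₂ D₂ : ℝ → Mat n}
    {g' J' A₁' D₁' A₂' D₂' : Mat n} {t : ℝ} (hg : HasDerivAt g g' t) (hJ : HasDerivAt J J' t)
    (hA₁ : HasDerivAt A₁ A₁' t) (hD₁ : HasDerivAt D₁ D₁' t) (hA₂ : HasDerivAt A₂ A₂' t)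
    (hD₂ : HasDerivAt D₂ D₂' t) :
    HasDerivAt (fun s => pencilForm a b (J s) (g s * A₁ s) (D₁ s) (g s * A₂ s) (D₂ s))
      (pairing (g' * A₁ t + comm J' (D₁ t)) (pencilOp a b (J t) (D₂ t))
        + pairing (g t * A₁ t + comm (J t) (D₁ t)) ((b / 2) • (J' * D₂ t + D₂ t * J'))
        - (pairing (g' * A₂ t) (pencilOp a b (J t) (D₁ t))
          + pairing (g t * A₂ t) ((b / 2) • (J' * D₁ t + D₁ t * J')))
        + pencilForm a b (J t) (g t * A₁') D₁' (g t * A₂ t) (D₂ t)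
        + pencilForm a b (J t) (g t * A₁ t) (D₁ t) (g t * A₂') D₂') t := by
  have hK : ∀ {D : ℝ → Mat n} {D' : Mat n}, HasDerivAt D D' t →
      HasDerivAt (fun s : ℝ => pencilOp a b (J s) (D s))
        (pencilOp a b (J t) D' + (b / 2) • (J' * D t + D t * J')) t := fun {D D'} hD => by
    refine ((hD.const_smul a).add
      (((hJ.mul hD).add (hD.mul hJ)).const_smul (b / 2))).congr_deriv ?_
    simp only [pencilOp]
    module
  refine ((((hg.mul hA₁).add ((hJ.mul hD₁).sub (hD₁.mul hJ))).pairing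
    (hK hD₂)).sub ((hg.mul hA₂).pairing (hK hD₁))).congr_deriv ?_
  simp only [pencilForm, comm, Pi.add_apply, Pi.sub_apply, Pi.mul_apply, pairing_add_left,
    pairing_add_right, pairing_sub_left]
  ring

/-- The derivative of a bracket along a Hamiltonian vector field: the derivative of the bivector
and two terms with second derivatives of the functions. -/
theorem Extends.pencil_pencil (a b : ℝ) (hG : Extends Ψ G) (hH : Extends Χ H)
    (x : Phase n) :
    SpinSutherland.pencil a b F (SpinSutherland.pencil a b G H) x
      = pencilVariation a b x.2 (nabla1 F x) (d2 F x) (nabla1 G x) (d2 G x) (nabla1 H x) (d2 H x)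
        - secondDiff Ψ x.toPair (hamField a b x.toPair (nabla1 F x) (d2 F x))
            (hamField a b x.toPair (nabla1 H x) (d2 H x))
        + secondDiff Χ x.toPair (hamField a b x.toPair (nabla1 F x) (d2 F x))
            (hamField a b x.toPair (nabla1 G x) (d2 G x)) := by
  rw [(hG.pencil a b hH).pencil_eq]
  obtain ⟨w, hw⟩ : ∃ w, w = hamField a b x.toPair (nabla1 F x) (d2 F x) := ⟨_, rfl⟩
  rw [← hw]
  obtain ⟨γ, hγ, hγ0⟩ : ∃ γ : ℝ → Mat n × Mat n, HasDerivAt γ w 0 ∧ γ 0 = x.toPair := by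
    refine ⟨fun t : ℝ => x.toPair + t • w, ?_, by simp⟩
    have h1 := ((hasDerivAt_id (0 : ℝ)).smul_const w).const_add x.toPair
    rw [one_smul] at h1
    exact h1
  have h1 : HasDerivAt (fun t : ℝ => (γ t).1) w.1 0 :=
    hasFDerivAt_fst.comp_hasDerivAt (f := γ) (0 : ℝ) hγ
  have h2 : HasDerivAt (fun t : ℝ => (γ t).2) w.2 0 :=
    hasFDerivAt_snd.comp_hasDerivAt (f := γ) (0 : ℝ) hγ
  have hA : ∀ {Φ F}, Extends Φ F → HasDerivAt (fun t : ℝ => gradFst (differential Φ (γ t)))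
      (gradFst (secondDiff Φ x.toPair w)) 0 := fun {Φ F} hF =>
    hasDerivAt_dualMatrix fun _ => hasDerivAt_differential (hF.contDiffAt x) hγ hγ0 _
  have hD : ∀ {Φ F}, Extends Φ F → HasDerivAt (fun t : ℝ => gradSnd (differential Φ (γ t)))
      (gradSnd (secondDiff Φ x.toPair w)) 0 := fun {Φ F} hF =>
    hasDerivAt_dualMatrix fun _ => hasDerivAt_differential (hF.contDiffAt x) hγ hγ0 _
  have key := hasDerivAt_pencilForm a b h1 h2 (hA hG) (hD hG) (hA hH) (hD hH)
  have key2 := hasDerivAt_comp ((hG.pencil a b hH).contDiffAt x) hγ hγ0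
  have hw1 : ∀ A, w.1 * A = -(pencilOp a b x.2 (d2 F x) * (x.1 * A)) := fun A => by
    rw [hw, hamField, neg_mul, neg_mul, mul_assoc]
    rfl
  have hw2 : w.2 = pencilOp a b x.2 (nabla1 F x + comm x.2 (d2 F x)) := by
    rw [hw]
    rfl
  rw [key2.unique key, hγ0, pencilForm_antisymm a b _ (_ * gradFst (secondDiff Ψ x.toPair w)),
    pencilForm_eq_hamField, pencilForm_eq_hamField, hw1, hw1, hw2]
  rw [hG.nabla1_eq x, hH.nabla1_eq x, hG.d2_eq x, hH.d2_eq x, pencilVariation]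
  simp only [Phase.toPair]
  ring

end PencilBracket

/-! ### Invariant functions -/

section Invariance

variable {n : ℕ} {Φ Ψ Χ : Mat n × Mat n → ℝ} {F G H : Phase n → ℝ}

theorem exists_extends (hF : F ∈ invariantRing n) : ∃ Φ, Extends Φ F := hF.1

theorem exp_mem_unitary {X : Mat n} (hX : X.conjTranspose = -X) :
    NormedSpace.exp X ∈ unitary (Mat n) := by
  have h : star (NormedSpace.exp X) = NormedSpace.exp (-X) := by
    rw [Matrix.star_eq_conjTranspose, ← Matrix.exp_conjTranspose, hX]
  rw [Unitary.mem_iff, h, ← Matrix.exp_add_of_commute _ _ (Commute.neg_left (Commute.refl X)),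
    ← Matrix.exp_add_of_commute _ _ (Commute.neg_right (Commute.refl X)), neg_add_cancel,
    add_neg_cancel, NormedSpace.exp_zero]
  exact ⟨rfl, rfl⟩

theorem conjTranspose_smul_neg {X : Mat n} (hX : X.conjTranspose = -X) (t : ℝ) :
    (t • X).conjTranspose = -(t • X) := by
  rw [Matrix.conjTranspose_smul, hX, star_trivial, smul_neg]

/-- Invariance under right multiplication by unitary matrices. -/
theorem isHermitian_nabla1' (hF : F ∈ invariantRing n) (x : Phase n) :
    (nabla1' F x).IsHermitian := by
  obtain ⟨Φ, hΦ⟩ := exists_extends hF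
  refine isHermitian_of_pairing_eq_zero fun X hX => ?_
  rw [hΦ.pairing_nabla1']
  refine (hΦ.hasDerivAt_right x X).unique ((hasDerivAt_const (0 : ℝ) (F x)).congr_of_eventuallyEq
    (Filter.Eventually.of_forall fun t => ?_))
  have h := (hF.2 ⟨_, exp_mem_unitary (conjTranspose_smul_neg hX t)⟩
    (x.1 * expGL (t • X)) x.2).1
  have hU : Unitary.toUnits (⟨_, exp_mem_unitary (conjTranspose_smul_neg hX t)⟩ : unitary (Mat n))
      = expGL (t • X) := Units.ext rfl
  rw [hU, mul_inv_cancel_right] at h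
  exact h.symm

/-- The infinitesimal form of invariance under `(g, J) ↦ (η g, η J η⁻¹)`. -/
theorem isHermitian_nabla1_add_comm (hF : F ∈ invariantRing n) (x : Phase n) :
    (nabla1 F x + comm x.2 (d2 F x)).IsHermitian := by
  obtain ⟨Φ, hΦ⟩ := exists_extends hF
  refine isHermitian_of_pairing_eq_zero fun X hX => ?_
  have h1 := hasDerivAt_expGL X
  have h2 := (h1.mul_const x.2).mul (hasDerivAt_expGL (-X))
  have h3 := hΦ.hasDerivAt (x := x)
    (c := fun t => (expGL (t • X) * x.1, (expGL (t • X) : Mat n) * x.2 * expGL (t • (-X))))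
    (by simp [expGL_zero]) (h1.mul_const (x.1 : Mat n)) h2
  have h4 := h3.unique ((hasDerivAt_const (0 : ℝ) (F x)).congr_of_eventuallyEq
    (Filter.Eventually.of_forall fun t => ?_))
  · simp only [zero_smul, expGL_zero, Units.val_one, mul_one, one_mul, mul_neg] at h4
    rw [covector_apply, ← hΦ.d2_eq, ← pairing_mul_cycle, ← hΦ.nabla1_eq, ← sub_eq_add_neg] at h4
    rw [pairing_add_left, pairing_symm (comm _ _), pairing_comm_right X]
    exact h4
  · have hU : Unitary.toUnits (⟨_, exp_mem_unitary (conjTranspose_smul_neg hX t)⟩ :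
        unitary (Mat n)) = expGL (t • X) := Units.ext rfl
    have h := (hF.2 ⟨_, exp_mem_unitary (conjTranspose_smul_neg hX t)⟩ x.1 x.2).2
    rw [hU] at h
    have hs : star (NormedSpace.exp (t • X)) = NormedSpace.exp (t • (-X)) := by
      rw [Matrix.star_eq_conjTranspose, ← Matrix.exp_conjTranspose, conjTranspose_smul_neg hX,
        smul_neg]
    simp only [hs] at h
    exact h

theorem expGL_conj (U : GLn n) (X : Mat n) (t : ℝ) :
    expGL (t • X) * U = U * expGL (t • (((U⁻¹ : GLn n) : Mat n) * X * (U : Mat n))) := by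
  ext1
  have h : t • (((U⁻¹ : GLn n) : Mat n) * X * U) = ((U⁻¹ : GLn n) : Mat n) * (t • X) * U := by
    rw [mul_smul_comm, smul_mul_assoc]
  rw [Units.val_mul, Units.val_mul, coe_expGL, coe_expGL, h, Matrix.exp_units_conj',
    mul_assoc, Units.mul_inv_cancel_left]

theorem nabla1_right (hF : F ∈ invariantRing n) (η : unitary (Mat n)) (g : GLn n) (J : Mat n) :
    nabla1 F (g * (Unitary.toUnits η)⁻¹, J) = nabla1 F (g, J) := by
  simp only [nabla1, ← mul_assoc, (hF.2 η _ J).1]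

theorem d2_right (hF : F ∈ invariantRing n) (η : unitary (Mat n)) (g : GLn n) (J : Mat n) :
    d2 F (g * (Unitary.toUnits η)⁻¹, J) = d2 F (g, J) := by
  simp only [d2, (hF.2 η _ _).1]

theorem nabla1_left (hF : F ∈ invariantRing n) (η : unitary (Mat n)) (g : GLn n) (J : Mat n) :
    nabla1 F (Unitary.toUnits η * g, (η : Mat n) * J * star (η : Mat n))
      = (η : Mat n) * nabla1 F (g, J) * star (η : Mat n) := by
  obtain ⟨Φ, hΦ⟩ := exists_extends hF
  refine eq_of_pairing_eq fun X => ?_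
  have h1 := hΦ.hasDerivAt_left (Unitary.toUnits η * g, (η : Mat n) * J * star (η : Mat n)) X
  rw [← hΦ.pairing_nabla1] at h1
  have h2 := hΦ.hasDerivAt_left (g, J) (star (η : Mat n) * X * η)
  rw [← hΦ.pairing_nabla1] at h2
  have h3 : ∀ t : ℝ, F (expGL (t • X) * (Unitary.toUnits η * g),
      (η : Mat n) * J * star (η : Mat n))
        = F (expGL (t • (star (η : Mat n) * X * (η : Mat n))) * g, J) := by
    intro t
    rw [← mul_assoc, expGL_conj, mul_assoc, (hF.2 η _ J).2]
    rfl
  simp only [h3] at h1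
  rw [h1.unique h2, mul_assoc (η : Mat n), pairing_mul_cycle, pairing_mul_left, mul_assoc]

theorem d2_left (hF : F ∈ invariantRing n) (η : unitary (Mat n)) (g : GLn n) (J : Mat n) :
    d2 F (Unitary.toUnits η * g, (η : Mat n) * J * star (η : Mat n))
      = (η : Mat n) * d2 F (g, J) * star (η : Mat n) := by
  obtain ⟨Φ, hΦ⟩ := exists_extends hF
  refine eq_of_pairing_eq fun X => ?_
  have h1 := hΦ.hasDerivAt_snd (Unitary.toUnits η * g, (η : Mat n) * J * star (η : Mat n)) X
  rw [← hΦ.pairing_d2] at h1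
  have h2 := hΦ.hasDerivAt_snd (g, J) (star (η : Mat n) * X * η)
  rw [← hΦ.pairing_d2] at h2
  have h3 : ∀ t : ℝ, F (Unitary.toUnits η * g, (η : Mat n) * J * star (η : Mat n) + t • X)
      = F (g, J + t • (star (η : Mat n) * X * η)) := by
    intro t
    rw [← (hF.2 η g (J + _)).2]
    congr 2
    have e : (η : Mat n) * (star (η : Mat n) * X * η) * star (η : Mat n) = X := by
      simp only [← mul_assoc]
      rw [Unitary.mul_star_self_of_mem η.2, one_mul, mul_assoc,
        Unitary.mul_star_self_of_mem η.2, mul_one]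
    rw [mul_add, add_mul, mul_smul_comm, smul_mul_assoc, e]
  simp only [h3] at h1
  rw [h1.unique h2, mul_assoc (η : Mat n), pairing_mul_cycle, pairing_mul_left, mul_assoc]

theorem pencilOp_conj (a b : ℝ) {U V : Mat n} (h : V * U = 1) (J X : Mat n) :
    pencilOp a b (U * J * V) (U * X * V) = U * pencilOp a b J X * V := by
  simp only [pencilOp, conj_mul_conj h, mul_add, add_mul, mul_smul_comm, smul_mul_assoc]

theorem pencilForm_conj (a b : ℝ) {U V : Mat n} (h : V * U = 1) (J N₁ D₁ N₂ D₂ : Mat n) :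
    pencilForm a b (U * J * V) (U * N₁ * V) (U * D₁ * V) (U * N₂ * V) (U * D₂ * V)
      = pencilForm a b J N₁ D₁ N₂ D₂ := by
  rw [pencilForm, comm_conj h, pencilOp_conj a b h, pencilOp_conj a b h, ← add_mul,
    ← mul_add, pairing_conj h, pairing_conj h, pencilForm]

theorem pencil_mem (a b : ℝ) (hF : F ∈ invariantRing n) (hH : H ∈ invariantRing n) :
    pencil a b F H ∈ invariantRing n := by
  obtain ⟨Φ, hΦ⟩ := exists_extends hF
  obtain ⟨Ψ, hΨ⟩ := exists_extends hH
  refine ⟨⟨_, hΦ.pencil a b hΨ⟩, fun η g J => ⟨?_, ?_⟩⟩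
  · simp only [pencil, nabla1_right hF, nabla1_right hH, d2_right hF, d2_right hH]
  · simp only [pencil, nabla1_left hF, nabla1_left hH, d2_left hF, d2_left hH]
    exact pencilForm_conj a b (Unitary.coe_star_mul_self η) _ _ _ _ _

theorem pencil_antisymm (a b : ℝ) (F H : Phase n → ℝ) : pencil a b F H = -pencil a b H F := by
  ext x
  exact pencilForm_antisymm a b _ _ _ _ _

theorem Extends.pencil_left (a b : ℝ) (hF : Extends Φ F) (H : Phase n → ℝ) (x : Phase n) :
    SpinSutherland.pencil a b F H x
      = -differential Φ x.toPair (hamField a b x.toPair (nabla1 H x) (d2 H x)) := by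
  rw [pencil_antisymm, Pi.neg_apply, hF.pencil_eq]

/-- The left and right translates of `∇₁F` to the unit are conjugate, so trilinear
invariants of them agree. -/
theorem pairing_nabla1_comm (hF : F ∈ invariantRing n) (hG : G ∈ invariantRing n)
    (hH : H ∈ invariantRing n) (x : Phase n) :
    pairing (nabla1 F x) (comm (nabla1 G x) (nabla1 H x)) = 0 := by
  have h : ∀ {F}, F ∈ invariantRing n →
      nabla1 F x = (x.1 : Mat n) * nabla1' F x * (x.1⁻¹ : GLn n) := fun hF => by
    obtain ⟨Φ, hΦ⟩ := exists_extends hF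
    rw [hΦ.nabla1_eq, hΦ.nabla1'_eq, ← mul_assoc, Units.mul_inv_cancel_right]
  rw [h hF, h hG, h hH, comm_conj (Units.inv_mul x.1),
    pairing_conj (Units.inv_mul x.1)]
  exact pairing_comm_eq_zero (isHermitian_nabla1' hF x) (isHermitian_nabla1' hG x)
    (isHermitian_nabla1' hH x)

theorem pencil_jacobi (a b : ℝ) (hF : F ∈ invariantRing n) (hG : G ∈ invariantRing n)
    (hH : H ∈ invariantRing n) :
    pencil a b F (pencil a b G H) + pencil a b G (pencil a b H F)
      + pencil a b H (pencil a b F G) = 0 := by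
  obtain ⟨Φ, hΦ⟩ := exists_extends hF
  obtain ⟨Ψ, hΨ⟩ := exists_extends hG
  obtain ⟨Χ, hΧ⟩ := exists_extends hH
  ext x
  have h := pencilVariation_cyclic_sum a b x.2 (nabla1 F x) (d2 F x) (nabla1 G x) (d2 G x)
    (nabla1 H x) (d2 H x)
  rw [pairing_nabla1_comm hF hG hH, pairing_comm_eq_zero (isHermitian_nabla1_add_comm hF x)
    (isHermitian_nabla1_add_comm hG x) (isHermitian_nabla1_add_comm hH x)] at h
  simp only [Pi.add_apply, Pi.zero_apply]
  rw [hΨ.pencil_pencil a b hΧ, hΧ.pencil_pencil a b hΦ, hΦ.pencil_pencil a b hΨ,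
    secondDiff_symm (hΦ.contDiffAt x) (hamField a b _ (nabla1 H x) _),
    secondDiff_symm (hΨ.contDiffAt x) (hamField a b _ (nabla1 H x) _),
    secondDiff_symm (hΧ.contDiffAt x) (hamField a b _ (nabla1 G x) _)]
  linear_combination h

theorem isPoissonBracketOn_pencil (a b : ℝ) :
    IsPoissonBracketOn (invariantRing n) (pencil a b) where
  closed _ hF _ hH := pencil_mem a b hF hH
  add_left F hF G hG H _ := by
    obtain ⟨Φ, hΦ⟩ := exists_extends hF
    obtain ⟨Ψ, hΨ⟩ := exists_extends hG
    ext x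
    rw [Pi.add_apply, (hΦ.add hΨ).pencil_left, hΦ.pencil_left, hΨ.pencil_left, differential,
      fderiv_add ((hΦ.contDiffAt x).differentiableAt (by simp))
        ((hΨ.contDiffAt x).differentiableAt (by simp)), ← neg_add]
    rfl
  smul_left c F hF H _ := by
    obtain ⟨Φ, hΦ⟩ := exists_extends hF
    ext x
    rw [Pi.smul_apply, (hΦ.smul c).pencil_left, hΦ.pencil_left, differential,
      fderiv_const_smul ((hΦ.contDiffAt x).differentiableAt (by simp)), smul_neg]
    rfl
  antisymm F _ H _ := pencil_antisymm a b F H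
  leibniz F hF G hG H _ := by
    obtain ⟨Φ, hΦ⟩ := exists_extends hF
    obtain ⟨Ψ, hΨ⟩ := exists_extends hG
    ext x
    rw [Pi.add_apply, Pi.mul_apply, Pi.mul_apply, (hΦ.mul hΨ).pencil_left, hΦ.pencil_left,
      hΨ.pencil_left, differential, fderiv_mul ((hΦ.contDiffAt x).differentiableAt (by simp))
        ((hΨ.contDiffAt x).differentiableAt (by simp)), hΦ.2, hΨ.2]
    simp only [differential, ContinuousLinearMap.coe_coe, _root_.add_apply,
      _root_.smul_apply, smul_eq_mul]
    ring
  jacobi _ hF _ hG _ hH := pencil_jacobi a b hF hG hH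

theorem bracket1_eq_pencil (F H : Phase n → ℝ) : bracket1 F H = pencil 1 0 F H := by
  ext x
  simp only [bracket1, pencil, pencilForm, pencilOp, one_smul, zero_div, zero_smul, add_zero,
    pairing_add_left, pairing_comm_left]
  ring

/-- On invariant functions the terms with the `r`-matrix drop out of the second bracket. -/
theorem bracket2_eq_pencil (hF : F ∈ invariantRing n) (hH : H ∈ invariantRing n) :
    bracket2 F H = pencil 0 1 F H := by
  ext x
  have hN' := pairing_rMat_eq_zero (isHermitian_nabla1' hF x) (isHermitian_nabla1' hH x)
  obtain ⟨YF, hYF⟩ : ∃ Y, Y = nabla1 F x + comm x.2 (d2 F x) := ⟨_, rfl⟩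
  obtain ⟨YH, hYH⟩ : ∃ Y, Y = nabla1 H x + comm x.2 (d2 H x) := ⟨_, rfl⟩
  have hY : pairing (rMat YF) YH = 0 := by
    rw [hYF, hYH]
    exact pairing_rMat_eq_zero (isHermitian_nabla1_add_comm hF x)
      (isHermitian_nabla1_add_comm hH x)
  have hT : ∀ {F : Phase n → ℝ} {Y : Mat n}, Y = nabla1 F x + comm x.2 (d2 F x) →
      rPlus (nabla2' F x) - rMinus (nabla2 F x)
        = rMat (nabla1 F x) - rMat Y + pencilOp 0 1 x.2 (d2 F x) := by
    intro F Y hY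
    have e : nabla2' F x - nabla2 F x = nabla1 F x - Y := by
      rw [hY, nabla2', nabla2, comm]
      abel
    rw [← rMat_sub, ← e, rMat_sub, rPlus, rMinus, pencilOp, nabla2, nabla2']
    ext i j
    simp
    ring
  have hd : nabla2 F x - nabla2' F x = YF - nabla1 F x := by
    rw [hYF, nabla2', nabla2, comm, add_sub_cancel_left]
  rw [bracket2, hN', hT hYF, hT hYH, hd, pencil, pencilForm, ← hYF]
  simp only [pairing_sub_left, pairing_sub_right, pairing_add_right]
  rw [pairing_rMat YF YH] at hY
  rw [pairing_symm (nabla1 H x) (rMat (nabla1 F x)), pairing_symm (nabla1 H x) (rMat YF),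
    pairing_rMat YF]
  linear_combination hY

theorem bracket_eq_pencil (a b : ℝ) (hF : F ∈ invariantRing n) (hH : H ∈ invariantRing n) :
    a • bracket1 F H + b • bracket2 F H = pencil a b F H := by
  rw [bracket1_eq_pencil, bracket2_eq_pencil hF hH]
  ext x
  simp only [Pi.add_apply, Pi.smul_apply, smul_eq_mul, pencil, pencilForm, pencilOp, one_smul,
    zero_smul, zero_div, add_zero, zero_add, pairing_add_left, pairing_add_right,
    pairing_smul_right]
  ring

end Invariance

/-! ### Restriction to the slice of diagonal matrices -/

section Slice

variable {n : ℕ} {F H : Phase n → ℝ}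

theorem exp_diagonal_ofReal (q : Fin n → ℝ) :
    NormedSpace.exp (Matrix.diagonal fun i => (q i : ℂ))
      = Matrix.diagonal fun i => ((Real.exp (q i) : ℝ) : ℂ) := by
  rw [Matrix.exp_diagonal]
  congr 1
  ext i
  rw [Pi.coe_exp, ← Complex.exp_eq_exp_ℂ, Complex.ofReal_exp]

theorem coe_incl_fst (x : RegSlice n) :
    ((incl x).1 : Mat n) = Matrix.diagonal fun i => ((Real.exp (x.1.1 i) : ℝ) : ℂ) :=
  exp_diagonal_ofReal _

theorem isOpen_strictAnti : IsOpen {q : Fin n → ℝ | StrictAnti q} := by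
  have h : {q : Fin n → ℝ | StrictAnti q}
      = ⋂ i : Fin n, ⋂ j : Fin n, ⋂ _ : i < j, {q | q j < q i} := by
    ext q
    simp only [Set.mem_ofPred_eq, Set.mem_iInter]
    exact Iff.rfl
  rw [h]
  exact isOpen_iInter_of_finite fun i => isOpen_iInter_of_finite fun j =>
    isOpen_iInter_of_finite fun _ => isOpen_lt (continuous_apply j) (continuous_apply i)

theorem expGL_diagonal_add (q : Fin n → ℝ) (i : Fin n) (t : ℝ) :
    expGL (Matrix.diagonal fun k => (((q + t • Pi.single i (1 : ℝ) : Fin n → ℝ) k : ℝ) : ℂ))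
      = expGL (t • (Matrix.single i i 1 : Mat n)) * expGL (Matrix.diagonal fun k => (q k : ℂ)) := by
  have h1 : (t • (Matrix.single i i 1 : Mat n))
      = Matrix.diagonal fun k => (((t • Pi.single i (1 : ℝ) : Fin n → ℝ) k : ℝ) : ℂ) := by
    rw [← Matrix.diagonal_single, ← Matrix.diagonal_smul]
    congr 1
    ext k
    by_cases hk : k = i
    · subst hk
      simp
    · simp [hk]
  ext1
  rw [Units.val_mul, h1, coe_expGL, coe_expGL, coe_expGL, exp_diagonal_ofReal, exp_diagonal_ofReal,
    exp_diagonal_ofReal, Matrix.diagonal_mul_diagonal]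
  congr 1
  ext k
  rw [Pi.add_apply, add_comm, Real.exp_add, Complex.ofReal_mul]

theorem pairing_single (Y : Mat n) (i : Fin n) :
    pairing Y (Matrix.single i i 1) = (Y i i).re := by
  rw [pairing, Matrix.trace_mul_single]
  simp

theorem redNabla1_restrict (hF : F ∈ invariantRing n) (x : RegSlice n) :
    redNabla1 (restrict n F) x = Matrix.diagonal fun i => ((nabla1 F (incl x) i i).re : ℂ) := by
  obtain ⟨Φ, hΦ⟩ := exists_extends hF
  rw [redNabla1]
  congr 1
  ext1 i
  congr 1
  have h := hΦ.hasDerivAt_left (incl x) (Matrix.single i i 1)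
  rw [← hΦ.pairing_nabla1, pairing_single] at h
  have hc : ContinuousAt (fun t : ℝ => x.1.1 + t • (Pi.single i (1 : ℝ) : Fin n → ℝ)) 0 := by
    fun_prop
  have hev := hc.eventually (isOpen_strictAnti.mem_nhds (by simp))
  refine (h.congr_of_eventuallyEq ?_).deriv
  filter_upwards [hev] with t ht
  have h1 := Subtype.val_injective.extend_apply (fun q : Chamber n => restrict n F (q, x.2)) 0
    ⟨_, ht⟩
  rw [h1]
  change F (expGL (Matrix.diagonal fun k => _), x.2) = _
  rw [expGL_diagonal_add]
  rfl

theorem redD2_restrict (F : Phase n → ℝ) (x : RegSlice n) :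
    redD2 (restrict n F) x = d2 F (incl x) := rfl

theorem aherm_nabla1 (hF : F ∈ invariantRing n) (x : Phase n) :
    aherm (nabla1 F x) = aherm (comm (d2 F x) x.2) := by
  have h := aherm_eq_zero_iff.2 (isHermitian_nabla1_add_comm hF x)
  rw [aherm_add, comm_swap, aherm_neg, ← sub_eq_add_neg, sub_eq_zero] at h
  exact h

/-- On the slice, invariance determines the off-diagonal part of `∇₁F` through `d₂F`: the
condition that `e^{-q} (∇₁F) e^q` is Hermitian relates the off-diagonal entries of the Hermitian
part of `∇₁F` to those of its anti-Hermitian part. -/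
theorem herm_nabla1 (hF : F ∈ invariantRing n) (x : RegSlice n) :
    herm (nabla1 F (incl x)) = redNabla1 (restrict n F) x
      + dynR x.1 (aherm (comm (d2 F (incl x)) x.2)) := by
  have e := aherm_nabla1 hF (incl x)
  change _ = aherm (comm (d2 F (incl x)) x.2) at e
  rw [← e, redNabla1_restrict hF]
  obtain ⟨Φ, hΦ⟩ := exists_extends hF
  have hN' := isHermitian_nabla1' hF (incl x)
  rw [hΦ.nabla1'_eq] at hN'
  rw [hΦ.nabla1_eq]
  rw [coe_incl_fst] at hN' ⊢
  obtain ⟨A, hA⟩ : ∃ A, A = gradFst (differential Φ (incl x).toPair) := ⟨_, rfl⟩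
  rw [← hA] at hN' ⊢
  ext i j
  by_cases hij : i = j
  · subst hij
    simp [herm, dynR]
    apply Complex.ext <;> simp <;> ring
  · have h1 := hN'.apply i j
    simp only [Matrix.mul_diagonal, star_mul'] at h1
    have hi : ((Real.exp (x.1.1 i) : ℝ) : ℂ) ≠ 0 := by
      exact_mod_cast (Real.exp_pos _).ne'
    have hj : ((Real.exp (x.1.1 j) : ℝ) : ℂ) ≠ 0 := by
      exact_mod_cast (Real.exp_pos _).ne'
    simp only [herm, aherm, dynR, Matrix.smul_apply, Matrix.add_apply, Matrix.sub_apply,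
      Matrix.conjTranspose_apply, Matrix.diagonal_mul, Matrix.of_apply, if_neg hij,
      Matrix.diagonal_apply_ne _ hij, star_mul', zero_add, smul_eq_mul, Complex.star_def,
      Complex.conj_ofReal] at h1 ⊢
    have hA' : (starRingEnd ℂ) (A j i)
        = A i j * (Real.exp (x.1.1 j) : ℝ) / (Real.exp (x.1.1 i) : ℝ) := by
      rw [eq_div_iff hi, h1]
    have hne : Real.exp (x.1.1 i) ^ 2 - Real.exp (x.1.1 j) ^ 2 ≠ 0 := by
      intro h0
      have h2 : Real.exp (x.1.1 i) = Real.exp (x.1.1 j) :=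
        (pow_left_inj₀ (Real.exp_pos _).le (Real.exp_pos _).le two_ne_zero).1 (sub_eq_zero.1 h0)
      exact hij (x.1.2.injective (Real.exp_injective h2))
    have hcoth : Real.cosh (x.1.1 i - x.1.1 j) / Real.sinh (x.1.1 i - x.1.1 j)
        = (Real.exp (x.1.1 i) ^ 2 + Real.exp (x.1.1 j) ^ 2)
          / (Real.exp (x.1.1 i) ^ 2 - Real.exp (x.1.1 j) ^ 2) := by
      rw [Real.cosh_eq, Real.sinh_eq, neg_sub, Real.exp_sub, Real.exp_sub,
        div_div_div_cancel_right₀ two_ne_zero]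
      have hi' := (Real.exp_pos (x.1.1 i)).ne'
      have hj' := (Real.exp_pos (x.1.1 j)).ne'
      rw [div_add_div _ _ hj' hi', div_sub_div _ _ hj' hi',
        div_div_div_cancel_right₀ (mul_ne_zero hj' hi')]
      ring_nf
    have hne' : ((Real.exp (x.1.1 i) : ℝ) : ℂ) ^ 2 - ((Real.exp (x.1.1 j) : ℝ) : ℂ) ^ 2 ≠ 0 := by
      exact_mod_cast hne
    rw [hcoth, hA']
    simp only [Complex.ofReal_div, Complex.ofReal_add, Complex.ofReal_sub, Complex.ofReal_pow]
    field_simp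

theorem pairing_diagPart (v : Fin n → ℂ) (X : Mat n) :
    pairing (Matrix.diagonal v) (diagPart X) = pairing (Matrix.diagonal v) X := by
  rw [pairing, pairing, diagPart, Matrix.diagonal_mul_diagonal]
  simp [Matrix.trace, Matrix.diagonal_mul]

/-- The trace form of `∇₁F` with a matrix, in terms of the derivatives of the restriction of `F`
to the slice. -/
theorem pairing_nabla1_incl (hF : F ∈ invariantRing n) (x : RegSlice n) (X : Mat n) :
    pairing (nabla1 F (incl x)) X = pairing (redNabla1 (restrict n F) x) (diagPart (herm X))
      + pairing (dynR x.1 (aherm (comm (d2 F (incl x)) x.2))) (herm X)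
      + pairing (aherm (comm (d2 F (incl x)) x.2)) (aherm X) := by
  have h : pairing (redNabla1 (restrict n F) x) (diagPart (herm X))
      = pairing (redNabla1 (restrict n F) x) (herm X) := pairing_diagPart _ _
  rw [h, ← pairing_add_left, ← herm_nabla1 hF, pairing_eq_herm_add_aherm, aherm_nabla1 hF]
  rfl

theorem pairing_aherm_comm (J X Y : Mat n) :
    pairing (aherm (comm X J)) (aherm Y) - pairing (aherm (comm Y J)) (aherm X)
        + pairing J (comm X Y)
      = pairing (aherm J) (comm (herm X) (herm Y) - comm (aherm X) (aherm Y)) := by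
  have h1 : (comm (herm X) (herm Y) - comm (aherm X) (aherm Y)).conjTranspose
      = -(comm (herm X) (herm Y) - comm (aherm X) (aherm Y)) := by
    rw [Matrix.conjTranspose_sub, conjTranspose_comm (isHermitian_herm X) (isHermitian_herm Y)]
    simp only [comm, Matrix.conjTranspose_sub, Matrix.conjTranspose_mul, conjTranspose_aherm]
    noncomm_ring
  have h2 : ∀ X Y : Mat n, pairing (aherm (comm X J)) (aherm Y) = pairing J (comm (aherm Y) X) := by
    intro X Y
    rw [pairing_aherm_left, aherm_of_conjTranspose_eq_neg (conjTranspose_aherm Y), pairing_symm,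
      ← pairing_comm_left, pairing_symm]
  rw [h2, h2, pairing_aherm_left J, aherm_of_conjTranspose_eq_neg h1, ← pairing_sub_right,
    ← pairing_add_right]
  congr 1
  obtain ⟨A, hA⟩ : ∃ A, A = herm X := ⟨_, rfl⟩
  obtain ⟨B, hB⟩ : ∃ B, B = aherm X := ⟨_, rfl⟩
  obtain ⟨C, hC⟩ : ∃ C, C = herm Y := ⟨_, rfl⟩
  obtain ⟨D, hD⟩ : ∃ D, D = aherm Y := ⟨_, rfl⟩
  have hX : X = A + B := by rw [hA, hB, herm_add_aherm]
  have hY : Y = C + D := by rw [hC, hD, herm_add_aherm]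
  rw [← hA, ← hB, ← hC, ← hD, hX, hY]
  simp only [comm]
  noncomm_ring

theorem redBracket1_restrict (hF : F ∈ invariantRing n) (hH : H ∈ invariantRing n) :
    redBracket1 (restrict n F) (restrict n H) = restrict n (bracket1 F H) := by
  ext x
  change _ = bracket1 F H (incl x)
  rw [redBracket1, bracket1, redD2_restrict, redD2_restrict, pairing_nabla1_incl hF,
    pairing_nabla1_incl hH, ← pairing_aherm_comm]
  simp only [incl]
  ring

theorem redBracket2_restrict (hF : F ∈ invariantRing n) (hH : H ∈ invariantRing n) :
    redBracket2 (restrict n F) (restrict n H) = restrict n (bracket2 F H) := by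
  ext x
  change _ = bracket2 F H (incl x)
  have hF' := pairing_nabla1_incl hF x (redNabla2 (restrict n H) x + redNabla2' (restrict n H) x)
  have hH' := pairing_nabla1_incl hH x (redNabla2 (restrict n F) x + redNabla2' (restrict n F) x)
  have hS : ∀ D : Mat n, pencilOp 0 1 x.2 D = (2⁻¹ : ℝ) • (x.2 * D + D * x.2) := fun D => by
    rw [pencilOp, zero_smul, zero_add, one_div]
  have hT : pairing (redNabla2 (restrict n F) x) (redNabla2 (restrict n H) x)
      = pairing (redNabla2' (restrict n F) x) (redNabla2' (restrict n H) x) := by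
    rw [redNabla2, redNabla2', redNabla2, redNabla2', pairing_mul_cycle, pairing_symm,
      mul_assoc, pairing_mul_cycle, pairing_symm]
  have hb : bracket2 F H (incl x) = 2⁻¹ *
      (pairing (nabla1 F (incl x)) (redNabla2 (restrict n H) x + redNabla2' (restrict n H) x)
      - pairing (nabla1 H (incl x)) (redNabla2 (restrict n F) x + redNabla2' (restrict n F) x)
      + pairing (redNabla2 (restrict n F) x - redNabla2' (restrict n F) x)
          (redNabla2 (restrict n H) x + redNabla2' (restrict n H) x)) := by
    rw [bracket2_eq_pencil hF hH, pencil, pencilForm]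
    change pairing (_ + comm x.2 _) (pencilOp 0 1 x.2 _) - pairing _ (pencilOp 0 1 x.2 _) = _
    rw [hS, hS, pairing_smul_right, pairing_smul_right, pairing_add_left]
    simp only [redNabla2, redNabla2', redD2_restrict, comm]
    ring
  have hc : ∀ F : Phase n → ℝ, comm (d2 F (incl x)) x.2
      = redNabla2' (restrict n F) x - redNabla2 (restrict n F) x := fun F => rfl
  rw [hb, hF', hH', redBracket2]
  simp only [redD2_restrict]
  obtain ⟨A, hA⟩ : ∃ A, A = redNabla2 (restrict n F) x := ⟨_, rfl⟩
  obtain ⟨A', hA'⟩ : ∃ A, A = redNabla2' (restrict n F) x := ⟨_, rfl⟩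
  obtain ⟨B, hB⟩ : ∃ A, A = redNabla2 (restrict n H) x := ⟨_, rfl⟩
  obtain ⟨B', hB'⟩ : ∃ A, A = redNabla2' (restrict n H) x := ⟨_, rfl⟩
  have key : pairing (aherm (comm (d2 F (incl x)) x.2)) (aherm (B + B'))
      - pairing (aherm (comm (d2 H (incl x)) x.2)) (aherm (A + A')) + pairing (A - A') (B + B')
      = pairing (herm A) (herm B') + pairing (aherm A') (aherm B)
        - pairing (herm A') (herm B) - pairing (aherm A) (aherm B') := by
    rw [← hA, ← hA', ← hB, ← hB'] at hT
    rw [hc, hc, ← hA, ← hA', ← hB, ← hB']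
    simp only [aherm_add, aherm_sub, pairing_sub_left, pairing_add_right]
    rw [pairing_eq_herm_add_aherm A B', pairing_eq_herm_add_aherm A' B,
      pairing_symm (aherm B), pairing_symm (aherm B), pairing_symm (aherm B'),
      pairing_symm (aherm B')]
    linear_combination hT
  rw [← hA, ← hA', ← hB, ← hB']
  linear_combination (-1 / 2 : ℝ) * key

theorem restrict_mem_torusInvariantRing (hF : F ∈ invariantRing n) :
    restrict n F ∈ torusInvariantRing n := by
  obtain ⟨Φ, hΦ⟩ := exists_extends hF
  refine ⟨⟨fun p => Φ (NormedSpace.exp (Matrix.diagonal fun i => (p.1 i : ℂ)), p.2), ?_,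
    fun x => hΦ.2 (incl x)⟩, fun τ hτ q J => ?_⟩
  · refine hΦ.1.comp (ContDiff.contDiffOn ?_) fun p _ => Matrix.isUnit_exp _
    have h : ∀ q : Fin n → ℝ, NormedSpace.exp (Matrix.diagonal fun i => (q i : ℂ))
        = ∑ i, Real.exp (q i) • (Matrix.single i i 1 : Mat n) := by
      intro q
      rw [exp_diagonal_ofReal]
      ext k l
      rw [Matrix.sum_apply]
      by_cases hkl : k = l
      · subst hkl
        simp [Matrix.single_apply]
      · rw [Matrix.diagonal_apply_ne _ hkl]
        refine (Finset.sum_eq_zero fun c _ => ?_).symm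
        rw [Matrix.smul_apply, Matrix.single_apply, if_neg fun h => hkl (h.1.symm.trans h.2),
          smul_zero]
    simp only [h]
    fun_prop
  · obtain ⟨g, hg⟩ : ∃ g : GLn n, g = (incl (q, J)).1 := ⟨_, rfl⟩
    have hcomm : Commute (Unitary.toUnits τ) g := by
      ext1
      rw [Units.val_mul, Units.val_mul, hg, coe_incl_fst, Unitary.val_toUnits_apply,
        ← hτ.diagonal_diag, Matrix.diagonal_mul_diagonal, Matrix.diagonal_mul_diagonal]
      simp only [mul_comm]
    change F ((incl (q, J)).1, _) = F ((incl (q, J)).1, J)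
    rw [← hg]
    have h := (hF.2 τ ((Unitary.toUnits τ)⁻¹ * g) J).2
    rw [mul_inv_cancel_left, hcomm.inv_left.eq, (hF.2 τ g J).1] at h
    exact h

theorem mem_reducedRing {f : RegSlice n → ℝ} :
    f ∈ reducedRing n ↔ ∃ F ∈ invariantRing n, restrict n F = f := by
  refine ⟨fun h => h.2, ?_⟩
  rintro ⟨F, hF, rfl⟩
  exact ⟨restrict_mem_torusInvariantRing hF, F, hF, rfl⟩

end Slice

/-! ### The reduced brackets -/

section Reduced

variable {n : ℕ} {F H : Phase n → ℝ}

theorem redBracket_restrict (a b : ℝ) (hF : F ∈ invariantRing n) (hH : H ∈ invariantRing n) :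
    a • redBracket1 (restrict n F) (restrict n H) + b • redBracket2 (restrict n F) (restrict n H)
      = restrict n (pencil a b F H) := by
  rw [redBracket1_restrict hF hH, redBracket2_restrict hF hH, ← bracket_eq_pencil a b hF hH,
    map_add, map_smul, map_smul]

theorem compatibleOn_reducedRing : CompatibleOn (reducedRing n) redBracket1 redBracket2 := by
  intro a b
  have hP := isPoissonBracketOn_pencil (n := n) a b
  constructor
  · rintro f hf h hh
    obtain ⟨F, hF, rfl⟩ := mem_reducedRing.1 hf
    obtain ⟨H, hH, rfl⟩ := mem_reducedRing.1 hh
    exact mem_reducedRing.2 ⟨_, hP.closed F hF H hH, (redBracket_restrict a b hF hH).symm⟩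
  · rintro f hf g hg h hh
    obtain ⟨F, hF, rfl⟩ := mem_reducedRing.1 hf
    obtain ⟨G, hG, rfl⟩ := mem_reducedRing.1 hg
    obtain ⟨H, hH, rfl⟩ := mem_reducedRing.1 hh
    rw [← map_add, redBracket_restrict a b (add_mem hF hG) hH, redBracket_restrict a b hF hH,
      redBracket_restrict a b hG hH, hP.add_left F hF G hG H hH, map_add]
  · rintro c f hf h hh
    obtain ⟨F, hF, rfl⟩ := mem_reducedRing.1 hf
    obtain ⟨H, hH, rfl⟩ := mem_reducedRing.1 hh
    rw [← map_smul, redBracket_restrict a b (Subalgebra.smul_mem _ hF c) hH,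
      redBracket_restrict a b hF hH, hP.smul_left c F hF H hH, map_smul]
  · rintro f hf h hh
    obtain ⟨F, hF, rfl⟩ := mem_reducedRing.1 hf
    obtain ⟨H, hH, rfl⟩ := mem_reducedRing.1 hh
    rw [redBracket_restrict a b hF hH, redBracket_restrict a b hH hF, hP.antisymm F hF H hH,
      map_neg]
  · rintro f hf g hg h hh
    obtain ⟨F, hF, rfl⟩ := mem_reducedRing.1 hf
    obtain ⟨G, hG, rfl⟩ := mem_reducedRing.1 hg
    obtain ⟨H, hH, rfl⟩ := mem_reducedRing.1 hh
    rw [← map_mul, redBracket_restrict a b (mul_mem hF hG) hH, redBracket_restrict a b hF hH,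
      redBracket_restrict a b hG hH, hP.leibniz F hF G hG H hH, map_add, map_mul, map_mul]
  · rintro f hf g hg h hh
    obtain ⟨F, hF, rfl⟩ := mem_reducedRing.1 hf
    obtain ⟨G, hG, rfl⟩ := mem_reducedRing.1 hg
    obtain ⟨H, hH, rfl⟩ := mem_reducedRing.1 hh
    rw [redBracket_restrict a b hG hH, redBracket_restrict a b hH hF, redBracket_restrict a b hF hG,
      redBracket_restrict a b hF (hP.closed G hG H hH),
      redBracket_restrict a b hG (hP.closed H hH F hF),
      redBracket_restrict a b hH (hP.closed F hF G hG), ← map_add, ← map_add,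
      hP.jacobi F hF G hG H hH, map_zero]

end Reduced

/-! ### The Hamiltonians -/

section Hamiltonians

variable {n : ℕ}

/-- The function `Re (z tr(J^k)) / k` on the phase space; `z = 1` and `z = -i` give the real and
the imaginary part of the trace. -/
def phaseHam (n : ℕ) (z : ℂ) (k : ℕ) : Phase n → ℝ := fun x => (z * (x.2 ^ k).trace).re / k

theorem restrict_phaseHam_one (k : ℕ) : restrict n (phaseHam n 1 k) = hamRe n k := by
  ext x
  change (1 * (x.2 ^ k).trace).re / k = _
  rw [one_mul, hamRe]

theorem restrict_phaseHam_neg_I (k : ℕ) :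
    restrict n (phaseHam n (-Complex.I) k) = hamIm n k := by
  ext x
  change (-Complex.I * (x.2 ^ k).trace).re / k = _
  simp [hamIm]

theorem phaseHam_eq_reTrace (z : ℂ) (k : ℕ) (x : Phase n) :
    phaseHam n z k x = reTrace n (z • x.2 ^ k) / k := by
  change _ = (z • x.2 ^ k).trace.re / k
  rw [Matrix.trace_smul, smul_eq_mul, phaseHam]

theorem phaseHam_mem (z : ℂ) (k : ℕ) : phaseHam n z k ∈ invariantRing n := by
  refine ⟨⟨fun p => reTrace n ((z • (1 : Mat n)) * p.2 ^ k) / k, ?_, fun x => ?_⟩,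
    fun η g J => ⟨rfl, ?_⟩⟩
  · exact (((reTrace n).contDiff.comp
      (contDiff_const.mul (contDiff_snd.pow k))).div_const _).contDiffOn
  · rw [phaseHam_eq_reTrace, ← smul_one_mul z (x.2 ^ k)]
  · have h : ((η : Mat n) * J * star (η : Mat n)) ^ k = (η : Mat n) * J ^ k * star (η : Mat n) :=
      Units.conj_pow (Unitary.toUnits η) J k
    rw [phaseHam, phaseHam, h, Matrix.trace_mul_comm, ← mul_assoc,
      Unitary.star_mul_self_of_mem η.2, one_mul]

theorem dualMatrix_zero : dualMatrix (fun _ : Mat n => 0) = 0 := by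
  ext i j
  simp [dualMatrix]

theorem nabla1_phaseHam (z : ℂ) (k : ℕ) (x : Phase n) : nabla1 (phaseHam n z k) x = 0 := by
  rw [nabla1, ← dualMatrix_zero]
  congr 1
  ext X
  exact deriv_const 0 (phaseHam n z k x)

/-- Powers of a matrix do not commute with its variation, but under the trace with a further power
of the matrix they can be differentiated as if they did. -/
theorem hasDerivAt_pow_line (J X : Mat n) (k : ℕ) :
    ∃ D : Mat n, HasDerivAt (fun t : ℝ => (J + t • X) ^ (k + 1)) D 0 ∧
      ∀ m : ℕ, (J ^ m * D).trace = (k + 1 : ℕ) * (J ^ (m + k) * X).trace := by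
  have h1 : HasDerivAt (fun t : ℝ => J + t • X) X 0 := by
    have h := ((hasDerivAt_id (0 : ℝ)).smul_const X).const_add J
    rw [one_smul] at h
    exact h
  induction k with
  | zero =>
    refine ⟨X, ?_, fun m => by simp⟩
    simp only [zero_add, pow_one]
    exact h1
  | succ k ih =>
    obtain ⟨D, hD, hm⟩ := ih
    refine ⟨D * J + J ^ (k + 1) * X, ?_, fun m => ?_⟩
    · have h := hD.mul h1
      simp only [zero_smul, add_zero] at h
      refine h.congr_of_eventuallyEq (Filter.Eventually.of_forall fun t => ?_)
      exact pow_succ _ _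
    · rw [mul_add, Matrix.trace_add, ← mul_assoc, Matrix.trace_mul_comm, ← mul_assoc, ← pow_succ',
        hm, ← mul_assoc, ← pow_add, add_right_comm m 1 k, add_assoc m k 1]
      push_cast
      ring

theorem d2_phaseHam (z : ℂ) (k : ℕ) (x : Phase n) :
    d2 (phaseHam n z (k + 1)) x = z • x.2 ^ k := by
  rw [← dualMatrix_pairing (z • x.2 ^ k), d2]
  congr 1
  ext X
  obtain ⟨D, hD, hm⟩ := hasDerivAt_pow_line x.2 X k
  have h1 := ((reTrace n).hasFDerivAt.comp_hasDerivAt (0 : ℝ)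
    (hD.const_mul (z • (1 : Mat n)))).div_const ((k + 1 : ℕ) : ℝ)
  have h2 := hm 0
  rw [pow_zero, one_mul, zero_add] at h2
  have h3 : reTrace n ((z • (1 : Mat n)) * D) / ((k + 1 : ℕ) : ℝ) = pairing (z • x.2 ^ k) X := by
    change ((z • (1 : Mat n)) * D).trace.re / _ = (z • x.2 ^ k * X).trace.re
    rw [smul_mul_assoc, smul_mul_assoc, one_mul, Matrix.trace_smul, Matrix.trace_smul, h2,
      smul_eq_mul, smul_eq_mul, mul_left_comm, ← Complex.ofReal_natCast, Complex.re_ofReal_mul,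
      mul_div_cancel_left₀ _ (by positivity)]
  rw [← h3]
  refine HasDerivAt.deriv (h1.congr_of_eventuallyEq (Filter.Eventually.of_forall fun t => ?_))
  refine (phaseHam_eq_reTrace z (k + 1) (x.1, x.2 + t • X)).trans ?_
  rw [← smul_one_mul z ((x.1, x.2 + t • X).2 ^ (k + 1))]
  rfl

theorem pencil_phaseHam_phaseHam (a b : ℝ) (z w : ℂ) {k l : ℕ} (hk : 1 ≤ k) (hl : 1 ≤ l) :
    pencil a b (phaseHam n z k) (phaseHam n w l) = 0 := by
  obtain ⟨k, rfl⟩ := Nat.exists_eq_add_of_le' hk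
  obtain ⟨l, rfl⟩ := Nat.exists_eq_add_of_le' hl
  ext x
  have h : comm x.2 (z • x.2 ^ k) = 0 := by
    rw [comm, mul_smul_comm, smul_mul_assoc, ← pow_succ, ← pow_succ', sub_self]
  rw [pencil, nabla1_phaseHam, nabla1_phaseHam, d2_phaseHam, d2_phaseHam, pencilForm, h]
  simp

/-- The recursion `∇₂h_k = ∇₂'h_k = d₂h_{k+1}` behind the bi-Hamiltonian relations. -/
theorem pencil_phaseHam (z : ℂ) {k : ℕ} (hk : 1 ≤ k) (F : Phase n → ℝ) :
    pencil 0 1 F (phaseHam n z k) = pencil 1 0 F (phaseHam n z (k + 1)) := by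
  obtain ⟨k, rfl⟩ := Nat.exists_eq_add_of_le' hk
  ext x
  have h : pencilOp 0 1 x.2 (z • x.2 ^ k) = pencilOp 1 0 x.2 (z • x.2 ^ (k + 1)) := by
    rw [pencilOp, pencilOp, mul_smul_comm, smul_mul_assoc, ← pow_succ, ← pow_succ']
    module
  rw [pencil, pencil, nabla1_phaseHam, nabla1_phaseHam, d2_phaseHam, d2_phaseHam, pencilForm,
    pencilForm, h, pairing_zero_left, pairing_zero_left]

end Hamiltonians

/-! ### Linear independence -/

section Independence

variable {n : ℕ}

/-- The invariant function `tr(g g*)`. -/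
def normSqGL (n : ℕ) : Phase n → ℝ := fun x => pairing (x.1 : Mat n) (x.1 : Mat n).conjTranspose

/-- The function `tr(g g*)` on pairs of matrices. -/
def normSqPair (n : ℕ) : Mat n × Mat n → ℝ := fun p => pairing p.1 p.1.conjTranspose

theorem extends_normSqPair : Extends (normSqPair n) (normSqGL n) := by
  refine ⟨ContDiffOn.pairing contDiffOn_fst ?_, fun _ => rfl⟩
  let C : Mat n →ₗ[ℝ] Mat n :=
    { toFun := Matrix.conjTranspose
      map_add' := Matrix.conjTranspose_add
      map_smul' := fun c X => by simp }
  exact (LinearMap.toContinuousLinearMap C).contDiff.comp_contDiffOn contDiffOn_fst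

theorem normSqGL_mem : normSqGL n ∈ invariantRing n := by
  refine ⟨⟨_, extends_normSqPair⟩, fun η g J => ⟨?_, ?_⟩⟩
  · change pairing ((g : Mat n) * star (η : Mat n)) ((g : Mat n) * star (η : Mat n)).conjTranspose
      = pairing (g : Mat n) (g : Mat n).conjTranspose
    rw [Matrix.conjTranspose_mul, ← Matrix.star_eq_conjTranspose (star _), star_star,
      pairing_mul_left, ← mul_assoc, Unitary.star_mul_self_of_mem η.2, one_mul]
  · change pairing ((η : Mat n) * (g : Mat n)) ((η : Mat n) * (g : Mat n)).conjTranspose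
      = pairing (g : Mat n) (g : Mat n).conjTranspose
    rw [Matrix.conjTranspose_mul, ← Matrix.star_eq_conjTranspose (η : Mat n), pairing_mul_cycle,
      mul_assoc, Unitary.star_mul_self_of_mem η.2, mul_one]

theorem d2_normSqGL (x : Phase n) : d2 (normSqGL n) x = 0 := by
  rw [d2, ← dualMatrix_zero]
  congr 1
  ext X
  exact deriv_const 0 (normSqGL n x)

/-- Euler's identity for the quadratic function `tr(g g*)`. -/
theorem pairing_nabla1_normSqGL (x : Phase n) :
    pairing (nabla1 (normSqGL n) x) 1 = 2 * normSqGL n x := by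
  rw [extends_normSqPair.pairing_nabla1, one_mul]
  have h1 : HasDerivAt (fun t : ℝ => ((1 + t) • (x.1 : Mat n), x.2)) ((x.1 : Mat n), 0) 0 := by
    have h := ((hasDerivAt_id (0 : ℝ)).const_add 1).smul_const (x.1 : Mat n)
    rw [one_smul] at h
    exact h.prodMk (hasDerivAt_const 0 x.2)
  have h2 := hasDerivAt_comp (extends_normSqPair.contDiffAt x) h1 (by simp [Phase.toPair])
  have h3 : HasDerivAt (fun t : ℝ => (1 + t) ^ 2 * normSqGL n x) (2 * normSqGL n x) 0 := by
    refine ((((hasDerivAt_id (0 : ℝ)).const_add 1).pow 2).mul_const _).congr_deriv ?_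
    simp
  refine h2.unique (h3.congr_of_eventuallyEq (Filter.Eventually.of_forall fun t => ?_))
  simp only [normSqPair, normSqGL, Matrix.conjTranspose_smul, star_trivial, pairing_smul_left,
    pairing_smul_right]
  ring

theorem normSqGL_ne_zero (hn : 1 ≤ n) (x : Phase n) : normSqGL n x ≠ 0 := by
  intro h
  have : Nonempty (Fin n) := ⟨⟨0, hn⟩⟩
  exact x.1.ne_zero (eq_zero_of_pairing_conjTranspose_self h)

theorem independentOn_reducedRing (hn : 1 ≤ n) :
    IndependentOn (reducedRing n) redBracket1 redBracket2 := by
  intro a b hab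
  have h := hab _ (mem_reducedRing.2 ⟨_, normSqGL_mem, rfl⟩)
    _ (mem_reducedRing.2 ⟨_, phaseHam_mem 1 1, rfl⟩)
  rw [redBracket_restrict a b normSqGL_mem (phaseHam_mem 1 1)] at h
  have hq : StrictAnti fun i : Fin n => -((i : ℕ) : ℝ) := fun i j hij =>
    neg_lt_neg (Nat.cast_lt.2 hij)
  -- At a multiple `s` of the unit matrix, the bracket with `Re tr J` is `(a + b s)` times a
  -- non-zero number.
  have key : ∀ s : ℝ, a + b * s = 0 := by
    intro s
    have h1 := congrFun h (⟨_, hq⟩, s • 1)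
    change pencilForm a b (s • 1) _ _ _ _ = 0 at h1
    rw [nabla1_phaseHam, d2_normSqGL, d2_phaseHam] at h1
    have e : pencilOp a b (s • (1 : Mat n)) ((1 : ℂ) • (incl (⟨_, hq⟩, s • (1 : Mat n))).2 ^ 0)
        = (a + b * s) • 1 := by
      rw [pencilOp, pow_zero, one_smul, mul_one, one_mul]
      module
    rw [pencilForm, e, pairing_zero_left, sub_zero, comm, mul_zero, zero_mul, sub_zero, add_zero,
      pairing_smul_right, pairing_nabla1_normSqGL] at h1
    exact (mul_eq_zero.1 h1).resolve_right (mul_ne_zero two_ne_zero (normSqGL_ne_zero hn _))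
  have ha := key 0
  have hb := key 1
  constructor <;> linarith

end Independence

end SpinSutherland

end

theorem proposition3p6 (n : ℕ) (hn : 1 ≤ n) :
    -- the two formulas are the reductions of the two brackets on `𝔐`
    (∀ F ∈ invariantRing n, ∀ H ∈ invariantRing n,
      redBracket1 (restrict n F) (restrict n H) = restrict n (bracket1 F H) ∧
      redBracket2 (restrict n F) (restrict n H) = restrict n (bracket2 F H)) ∧
    -- they are compatible, linearly independent Poisson brackets on the reduced ring
    IsPoissonBracketOn (reducedRing n) redBracket1 ∧
    IsPoissonBracketOn (reducedRing n) redBracket2 ∧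
    CompatibleOn (reducedRing n) redBracket1 redBracket2 ∧
    IndependentOn (reducedRing n) redBracket1 redBracket2 ∧
    -- the Hamiltonians belong to the reduced ring
    (∀ k : ℕ, 1 ≤ k → hamRe n k ∈ reducedRing n ∧ hamIm n k ∈ reducedRing n) ∧
    -- they commute with respect to both brackets
    (∀ k l : ℕ, 1 ≤ k → 1 ≤ l →
      redBracket1 (hamRe n k) (hamRe n l) = 0 ∧ redBracket1 (hamRe n k) (hamIm n l) = 0 ∧
      redBracket1 (hamIm n k) (hamIm n l) = 0 ∧
      redBracket2 (hamRe n k) (hamRe n l) = 0 ∧ redBracket2 (hamRe n k) (hamIm n l) = 0 ∧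
      redBracket2 (hamIm n k) (hamIm n l) = 0) ∧
    -- the bi-Hamiltonian relations
    (∀ f ∈ reducedRing n, ∀ k : ℕ, 1 ≤ k →
      redBracket2 f (hamRe n k) = redBracket1 f (hamRe n (k + 1)) ∧
      redBracket2 f (hamIm n k) = redBracket1 f (hamIm n (k + 1))) := by
  have hRe : ∀ k, hamRe n k ∈ reducedRing n := fun k =>
    mem_reducedRing.2 ⟨_, phaseHam_mem 1 k, restrict_phaseHam_one k⟩
  have hIm : ∀ k, hamIm n k ∈ reducedRing n := fun k =>
    mem_reducedRing.2 ⟨_, phaseHam_mem (-Complex.I) k, restrict_phaseHam_neg_I k⟩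
  have hred : ∀ F ∈ invariantRing n, ∀ H ∈ invariantRing n,
      redBracket1 (restrict n F) (restrict n H) = restrict n (pencil 1 0 F H) ∧
      redBracket2 (restrict n F) (restrict n H) = restrict n (pencil 0 1 F H) := fun F hF H hH =>
    ⟨by rw [redBracket1_restrict hF hH, bracket1_eq_pencil],
      by rw [redBracket2_restrict hF hH, bracket2_eq_pencil hF hH]⟩
  refine ⟨fun F hF H hH => ⟨redBracket1_restrict hF hH, redBracket2_restrict hF hH⟩, ?_, ?_,
    compatibleOn_reducedRing, independentOn_reducedRing hn, fun k _ => ⟨hRe k, hIm k⟩, ?_, ?_⟩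
  · have h := compatibleOn_reducedRing (n := n) 1 0
    simp only [one_smul, zero_smul, add_zero] at h
    exact h
  · have h := compatibleOn_reducedRing (n := n) 0 1
    simp only [one_smul, zero_smul, zero_add] at h
    exact h
  · intro k l hk hl
    have h : ∀ z w : ℂ,
        redBracket1 (restrict n (phaseHam n z k)) (restrict n (phaseHam n w l)) = 0 ∧
        redBracket2 (restrict n (phaseHam n z k)) (restrict n (phaseHam n w l)) = 0 := by
      intro z w
      rw [(hred _ (phaseHam_mem z k) _ (phaseHam_mem w l)).1,
        (hred _ (phaseHam_mem z k) _ (phaseHam_mem w l)).2, pencil_phaseHam_phaseHam _ _ _ _ hk hl,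
        pencil_phaseHam_phaseHam _ _ _ _ hk hl, map_zero]
      exact ⟨rfl, rfl⟩
    simp only [← restrict_phaseHam_one, ← restrict_phaseHam_neg_I]
    exact ⟨(h _ _).1, (h _ _).1, (h _ _).1, (h _ _).2, (h _ _).2, (h _ _).2⟩
  · intro f hf k hk
    obtain ⟨F, hF, rfl⟩ := mem_reducedRing.1 hf
    have h : ∀ z : ℂ, redBracket2 (restrict n F) (restrict n (phaseHam n z k))
        = redBracket1 (restrict n F) (restrict n (phaseHam n z (k + 1))) := by
      intro z
      rw [(hred _ hF _ (phaseHam_mem z k)).2, (hred _ hF _ (phaseHam_mem z (k + 1))).1,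
        pencil_phaseHam z hk]
    simp only [← restrict_phaseHam_one, ← restrict_phaseHam_neg_I]
    exact ⟨h _, h _⟩
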